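/- Let $V$ be a finite-dimensional real Euclidean space with inner product $(\cdot\mid\cdot)$. A (not necessarily crystallographic) root system in $V$ is a finite set $\Phi$ of nonzero vectors of $V$ such that, for every $\alpha\in\Phi$, $\Phi\cap\mathbb{R}\alpha=\{\alpha,-\alpha\}$ and $s_\alpha(\Phi)=\Phi$, where $s_\alpha$ is the orthogonal reflection in the hyperplane $\alpha^\perp$; root lengths are otherwise arbitrary. Its rank is $\dim\operatorname{span}_{\mathbb{R}}\Phi$. Simple roots of $\Phi$ are linearly independent $\alpha_1,\dots,\alpha_n\in\Phi$ such that every element of $\Phi$ is a real linear combination $\sum_{i=1}^n c_i\alpha_i$ with all $c_i\ge 0$ or all $c_i\le 0$. The corresponding positive roots are $\Phi^+=\{\beta\in\Phi : \beta=\sum_{i=1}^n c_i\alpha_i \text{ with all } c_i\in\mathbb{R}_{\ge 0}\}$, and the root order on $\Phi^+$ is defined by $\beta\le\gamma$ if $\gamma-\beta=\sum_{i=1}^n c_i\alpha_i$ with all $c_i\in\mathbb{R}_{\ge 0}$. **Proposition 2.12 (with Corollary 2.11).** Let $\Phi$ be a root system in $V$ with simple roots $\alpha_1,\dots,\alpha_n$,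 and let $\Lambda\subseteq\Phi^+$ be an antichain for the root order, that is, any two distinct elements of $\Lambda$ are incomparable. Then $\Lambda$ is a linearly independent set. In particular, $\Lambda$ has at most $n$ elements, where $n$ is the rank of $\Phi$. -/

import Mathlib

/-- A finite, reduced, not necessarily crystallographic root system in a Euclidean space: a finite
set of nonzero vectors that meets the line through each `α ∈ Φ` in `{α, -α}` only, and that is
stable under the orthogonal reflection in the hyperplane perpendicular to each `α ∈ Φ`.
It is not required to span the space, and root lengths are arbitrary. -/
structure IsEuclideanRootSystem {V : Type*} [NormedAddCommGroup V] [InnerProductSpace ℝ V]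
    (Φ : Set V) : Prop where
  finite : Φ.Finite
  zero_notMem : (0 : V) ∉ Φ
  inter_line : ∀ α ∈ Φ, Φ ∩ (Submodule.span ℝ {α} : Set V) = {α, -α}
  reflection_image : ∀ α ∈ Φ, (Submodule.span ℝ {α})ᗮ.reflection '' Φ = Φ

/-- The vector `v` is a linear combination of the `α i` with nonnegative real coefficients. -/
def IsNonnegComb {V : Type*} [AddCommGroup V] [Module ℝ V] {n : ℕ} (α : Fin n → V) (v : V) :
    Prop :=
  ∃ c : Fin n → ℝ, (∀ i, 0 ≤ c i) ∧ v = ∑ i, c i • α i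

/-- `α 0, …, α (n - 1)` is a choice of simple roots of `Φ`: linearly independent roots such that
every root is a combination of them with coefficients all `≥ 0` or all `≤ 0`. -/
structure IsSimpleSystem {V : Type*} [AddCommGroup V] [Module ℝ V] (Φ : Set V) {n : ℕ}
    (α : Fin n → V) : Prop where
  mem : ∀ i, α i ∈ Φ
  linearIndependent : LinearIndependent ℝ α
  nonneg_or_nonpos : ∀ β ∈ Φ, IsNonnegComb α β ∨ IsNonnegComb α (-β)

/-- The set `Φ⁺` of positive roots with respect to the simple roots `α`. -/
def positiveRoots {V : Type*} [AddCommGroup V] [Module ℝ V] (Φ : Set V) {n : ℕ}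
    (α : Fin n → V) : Set V :=
  {β | β ∈ Φ ∧ IsNonnegComb α β}

/-- The root order: `β ≤ γ` if `γ - β` is a combination of simple roots with nonnegative real
coefficients. -/
def RootLE {V : Type*} [AddCommGroup V] [Module ℝ V] {n : ℕ} (α : Fin n → V) (β γ : V) : Prop :=
  IsNonnegComb α (γ - β)

/-- The rank of a root system: the dimension of its linear span. -/
noncomputable def rootSystemRank {V : Type*} [AddCommGroup V] [Module ℝ V] (Φ : Set V) : ℕ :=
  Module.finrank ℝ (Submodule.span ℝ Φ)

/-! ### Normalized root systems and the half-space criterion -/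

open Finset

/-! Rescale every root to norm square 2 and use coordinates with respect to the rescaled simple
roots. Scaling the simple roots by positive factors leaves the root order unchanged. Scaling the
elements of an antichain may destroy incomparability, but two roots of equal original length are
scaled by the same factor and stay incomparable. What survives is a length antichain
(`IsLengthAntichain`). This weaker condition already forces linear independence
(`linearIndepOn_of_isLengthAntichain`), which rescaling does not affect, so arbitrary root lengths
are covered.

A disconnected diagram splits roots and coordinates into two blocks, so induction on the number of
simple roots reduces to connected diagrams, where only a partial classification is needed.

Simply laced diagrams: products of positive roots are integers, so distinct positive roots with
positive product differ by a root and are comparable. A length antichain is then pairwise nonacute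
inside a half-space, hence independent by `linearIndepOn_of_nonacute`. The types A, D, E are never
listed.

Rank two: the coordinates of the roots are explicit sines, and a length antichain has at most two
elements.

A bond `-√2` at an end of the diagram: the diagram is of type B, with roots `√2 • E i` and `E j ± E
i` for an orthonormal family `E`. A length antichain has at most one root of the first kind and, for
each `j`, at most one of the second; triangularity and a suitable linear functional give
independence.

The remaining diagrams are H₃, H₄ and F₄. Their positive roots are tabulated over `ℤ[φ]`, and a
search evaluated by the kernel checks all antichains (`linearIndepOn_of_table`).

Every other connected diagram is excluded by evaluating the positive definite form at a suitable
vector. -/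

/-- A root system with all roots rescaled to norm square `2`, written in coordinates with respect to
the simple roots; `len` records the original length of each root, up to a common factor. -/
structure NormalizedSystem {ι : Type*} [DecidableEq ι]
    (B : LinearMap.BilinForm ℝ (ι → ℝ)) (N : Set (ι → ℝ)) (len : (ι → ℝ) → ℝ) : Prop where
  symm : ∀ x y, B x y = B y x
  pos : ∀ x, x ≠ 0 → 0 < B x x
  finite : N.Finite
  norm : ∀ x ∈ N, B x x = 2
  single_mem : ∀ i, Pi.single i 1 ∈ N
  refl_mem : ∀ i, ∀ x ∈ N, x - B x (Pi.single i 1) • Pi.single i 1 ∈ N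
  len_refl : ∀ i, ∀ x ∈ N, len (x - B x (Pi.single i 1) • Pi.single i 1) = len x
  sign : ∀ x ∈ N, 0 ≤ x ∨ x ≤ 0

theorem bilin_eq_sum {ι : Type*} [Fintype ι] [DecidableEq ι] (B : LinearMap.BilinForm ℝ (ι → ℝ))
    (x y : ι → ℝ) : B x y = ∑ i, y i * B x (Pi.single i 1) := by
  conv_lhs => rw [pi_eq_sum_univ' y]
  simp [map_sum]

/-- Vectors of a half-space whose mutual products are nonpositive are linearly independent. -/
theorem linearIndepOn_of_nonacute {ι : Type*} [Fintype ι] {B : LinearMap.BilinForm ℝ (ι → ℝ)}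
    (hpos : ∀ x, x ≠ 0 → 0 < B x x) {Λ : Set (ι → ℝ)} (h0 : ∀ x ∈ Λ, 0 ≤ x) (hne : ∀ x ∈ Λ, x ≠ 0)
    (hB : ∀ x ∈ Λ, ∀ y ∈ Λ, x ≠ y → B x y ≤ 0) : LinearIndepOn ℝ id Λ := by
  classical
  have key : ∀ (t : Finset (ι → ℝ)) (g : (ι → ℝ) → ℝ), ↑t ⊆ Λ → (∀ x, 0 ≤ g x) →
      ∑ x ∈ t, g x • x = 0 → ∀ x ∈ t, g x = 0 := by
    intro t g ht hg hs x hx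
    have h1 : ∀ y ∈ t, (0 : ι → ℝ) ≤ g y • y := fun y hy => smul_nonneg (hg y) (h0 y (ht hy))
    have h2 := (Finset.sum_eq_zero_iff_of_nonneg h1).1 hs x hx
    exact (smul_eq_zero.1 h2).resolve_right (hne x (ht hx))
  rw [linearIndepOn_iff']
  intro t g ht hs
  -- The positive and negative parts of the relation give one vector `v = w` with `B v w ≤ 0`, so `v
  -- = 0`. A vanishing sum of vectors with nonnegative coordinates then has only zero terms.
  set v := ∑ x ∈ t, max (g x) 0 • x with hv
  set w := ∑ x ∈ t, max (-g x) 0 • x with hw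
  have hvw : v = w := by
    rw [← sub_eq_zero, hv, hw, ← Finset.sum_sub_distrib, ← hs]
    refine Finset.sum_congr rfl fun x _ => ?_
    rw [← sub_smul]
    congr 1
    rcases le_total (g x) 0 with h | h
    · rw [max_eq_right h, max_eq_left (by linarith)]; ring
    · rw [max_eq_left h, max_eq_right (by linarith)]; ring
  have hle : B v w ≤ 0 := by
    rw [hv, hw, map_sum B, LinearMap.sum_apply]
    refine Finset.sum_nonpos fun x hx => ?_
    rw [map_sum]
    refine Finset.sum_nonpos fun y hy => ?_
    rw [map_smul, map_smul, LinearMap.smul_apply, smul_eq_mul, smul_eq_mul, ← mul_assoc]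
    by_cases hxy : x = y
    · subst hxy
      have : max (-g x) 0 * max (g x) 0 = 0 := by
        rcases le_total (g x) 0 with h | h
        · rw [max_eq_right h, mul_zero]
        · rw [max_eq_right (a := -g x) (by linarith), zero_mul]
      rw [this, zero_mul]
    · exact mul_nonpos_of_nonneg_of_nonpos (by positivity) (hB x (ht hx) y (ht hy) hxy)
  have hv0 : v = 0 := by
    by_contra hne'
    have := hpos v hne'
    rw [← hvw] at hle
    linarith
  intro x hx
  have a1 := key t (fun x => max (g x) 0) ht (fun x => le_max_right _ _) hv0 x hx
  have a2 := key t (fun x => max (-g x) 0) ht (fun x => le_max_right _ _)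
    (hvw.symm.trans hv0) x hx
  have b1 := le_max_left (g x) 0
  have b2 := le_max_left (-g x) 0
  linarith

/-! ### Positive roots and simple reflections -/

namespace NormalizedSystem

set_option linter.unusedSectionVars false

variable {ι : Type*} [Fintype ι] [DecidableEq ι] {B : LinearMap.BilinForm ℝ (ι → ℝ)}
  {N : Set (ι → ℝ)} {len : (ι → ℝ) → ℝ}

theorem ne_zero (h : NormalizedSystem B N len) {x : ι → ℝ} (hx : x ∈ N) : x ≠ 0 := by
  rintro rfl
  simpa using h.norm 0 hx

theorem single_norm (h : NormalizedSystem B N len) (i : ι) :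
    B (Pi.single i 1) (Pi.single i 1) = 2 := h.norm _ (h.single_mem i)

/-- A simple reflection sends a positive root other than its own simple root to a positive root. -/
theorem refl_nonneg (h : NormalizedSystem B N len) {i : ι} {x : ι → ℝ} (hx : x ∈ N) (h0 : 0 ≤ x)
    (hne : x ≠ Pi.single i 1) : 0 ≤ x - B x (Pi.single i 1) • Pi.single i 1 := by
  refine (h.sign _ (h.refl_mem i x hx)).resolve_right fun hneg => hne ?_
  -- The reflection changes only coordinate `i`. If its result were nonpositive, all other
  -- coordinates of `x` would vanish.
  have h1 : x = x i • Pi.single i 1 := by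
    funext j
    by_cases hj : j = i
    · subst hj; simp
    · have h2 := hneg j
      have h3 := h0 j
      simp only [Pi.sub_apply, Pi.smul_apply, Pi.single_eq_of_ne hj, smul_zero, sub_zero,
        Pi.zero_apply] at h2 h3 ⊢
      exact le_antisymm h2 h3
  have h2 := h.norm x hx
  rw [h1] at h2
  simp only [map_smul, LinearMap.smul_apply, smul_eq_mul, h.single_norm] at h2
  have h3 : 0 ≤ x i := h0 i
  have h4 : x i = 1 := by nlinarith
  rw [h1, h4, one_smul]

theorem exists_pos (h : NormalizedSystem B N len) {x : ι → ℝ} (hx : x ∈ N) (h0 : 0 ≤ x) :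
    ∃ i, 0 < B x (Pi.single i 1) := by
  by_contra! hcon
  have h1 := h.norm x hx
  rw [bilin_eq_sum] at h1
  have : ∑ i, x i * B x (Pi.single i 1) ≤ 0 :=
    Finset.sum_nonpos fun i _ => mul_nonpos_of_nonneg_of_nonpos (h0 i) (hcon i)
  linarith

theorem refl_refl (h : NormalizedSystem B N len) (i : ι) (x : ι → ℝ) :
    (x - B x (Pi.single i 1) • Pi.single i 1) -
      B (x - B x (Pi.single i 1) • Pi.single i 1) (Pi.single i 1) • Pi.single i (1 : ℝ) = x := by
  simp only [map_sub, map_smul, LinearMap.sub_apply, LinearMap.smul_apply, smul_eq_mul,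
    h.single_norm]
  module

/-- Every positive root is obtained from a simple root by simple reflections through positive
roots. -/
theorem positive_induction (h : NormalizedSystem B N len) (P : (ι → ℝ) → Prop)
    (hs : ∀ i, P (Pi.single i 1))
    (hr : ∀ i, ∀ x ∈ N, 0 ≤ x → x ≠ Pi.single i 1 → P x →
      P (x - B x (Pi.single i 1) • Pi.single i 1)) :
    ∀ x ∈ N, 0 ≤ x → P x := by
  by_contra! hcon
  obtain ⟨y, hyN, hy0, hyP⟩ := hcon
  have hfin : ({x | x ∈ N ∧ 0 ≤ x ∧ ¬ P x} : Set (ι → ℝ)).Finite :=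
    h.finite.subset fun x hx => hx.1
  -- A counterexample of least coordinate sum: reflecting in a simple root with positive product
  -- lowers the sum.
  obtain ⟨x, ⟨hxN, hx0, hxP⟩, hmin⟩ :=
    hfin.exists_minimalFor (fun x => ∑ i, x i) _ ⟨y, hyN, hy0, hyP⟩
  obtain ⟨i, hi⟩ := h.exists_pos hxN hx0
  have hne : x ≠ Pi.single i 1 := fun he => hxP (he ▸ hs i)
  set z := x - B x (Pi.single i 1) • Pi.single i 1 with hz
  have hzN : z ∈ N := h.refl_mem i x hxN
  have hz0 : 0 ≤ z := h.refl_nonneg hxN hx0 hne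
  have hsum : ∑ j, z j = ∑ j, x j - B x (Pi.single i 1) := by
    simp [hz, Finset.sum_sub_distrib, Pi.single_apply]
  have hzP : P z := by
    by_contra hzP
    have := hmin ⟨hzN, hz0, hzP⟩ (by simp only [hsum]; linarith)
    simp only [hsum] at this
    linarith
  have hzi : z ≠ Pi.single i 1 := by
    intro he
    have h1 := h.refl_refl i x
    rw [← hz, he, h.single_norm] at h1
    have h2 := hx0 i
    rw [← h1] at h2
    simp at h2
  have := hr i z hzN hz0 hzi hzP
  rw [hz, h.refl_refl] at this
  exact hxP this

/-- The set of roots is stable under the reflections in all positive roots. -/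
theorem refl_mem_of_mem (h : NormalizedSystem B N len) :
    ∀ y ∈ N, 0 ≤ y → ∀ x ∈ N, x - B x y • y ∈ N := by
  refine h.positive_induction (fun y => ∀ x ∈ N, x - B x y • y ∈ N) (fun i => h.refl_mem i)
    fun i y _ _ _ hP x hx => ?_
  -- The reflection in `s_i y` is the conjugate `s_i s_y s_i`.
  have h1 := h.refl_mem i _ (hP _ (h.refl_mem i x hx))
  convert h1 using 1
  have hii := h.single_norm i
  have hc := h.symm (Pi.single i 1) y
  simp only [map_sub, map_smul, LinearMap.sub_apply, LinearMap.smul_apply, smul_eq_mul, hii, hc]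
  module

/-- The reflection in simple root `j` keeps simple root `i` positive, and the `j`-th coordinate of
the result is minus this product. -/
theorem single_nonpos (h : NormalizedSystem B N len) {i j : ι} (hij : i ≠ j) :
    B (Pi.single i 1) (Pi.single j 1) ≤ 0 := by
  have hne : (Pi.single i 1 : ι → ℝ) ≠ Pi.single j 1 := by
    intro he
    have := congrFun he i
    simp [Pi.single_eq_of_ne hij] at this
  have := h.refl_nonneg (h.single_mem i) (Pi.single_nonneg.2 zero_le_one) hne j
  simp [Pi.single_eq_of_ne hij.symm] at this
  exact this

/-- A root is determined up to sign by its line. -/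
theorem eq_of_smul (h : NormalizedSystem B N len) {x y : ι → ℝ} (hx : x ∈ N) (hy : y ∈ N)
    {c : ℝ} (hc : 0 ≤ c) (hxy : x = c • y) : x = y := by
  have h1 := h.norm x hx
  rw [hxy] at h1
  simp only [map_smul, LinearMap.smul_apply, smul_eq_mul, h.norm y hy] at h1
  have : c = 1 := by nlinarith
  rw [hxy, this, one_smul]

theorem lt_two (h : NormalizedSystem B N len) {x y : ι → ℝ} (hx : x ∈ N) (hy : y ∈ N)
    (hxy : x ≠ y) : B x y < 2 := by
  have h1 := h.pos (x - y) (sub_ne_zero.2 hxy)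
  simp only [map_sub, LinearMap.sub_apply, h.norm x hx, h.norm y hy, h.symm y x] at h1
  linarith

end NormalizedSystem

/-! ### Length antichains, simply laced diagrams, and angles between simple roots -/

/-- Distinct elements of `Λ` of equal length are incomparable. -/
def IsLengthAntichain {ι : Type*} (len : (ι → ℝ) → ℝ) (Λ : Set (ι → ℝ)) : Prop :=
  ∀ x ∈ Λ, ∀ y ∈ Λ, x ≠ y → len x = len y → ¬ x ≤ y

/-- The graph of non-orthogonality on the simple roots is connected. -/
def IsConnectedForm {ι : Type*} [DecidableEq ι] (B : LinearMap.BilinForm ℝ (ι → ℝ)) : Prop :=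
  ∀ S : Set ι, S.Nonempty → (∀ i ∈ S, ∀ j, B (Pi.single i 1) (Pi.single j 1) ≠ 0 → j ∈ S) →
    ∀ j, j ∈ S

/-- The roots of a dihedral root system with angle `π - θ` between the simple roots. -/
noncomputable def dihedralRoot {ι : Type*} [DecidableEq ι] (θ : ℝ) (i j : ι) (k : ℕ) : ι → ℝ :=
  (Real.sin θ)⁻¹ • (Real.sin ((k + 1) * θ) • Pi.single i 1 + Real.sin (k * θ) • Pi.single j 1)

namespace NormalizedSystem

set_option linter.unusedSectionVars false

variable {ι : Type*} [Fintype ι] [DecidableEq ι] {B : LinearMap.BilinForm ℝ (ι → ℝ)}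
  {N : Set (ι → ℝ)} {len : (ι → ℝ) → ℝ}

/-- All products of positive roots are integers, and for distinct roots they are below 2. A positive
product is therefore 1, so the reflection of `x` in `y` is `x - y`; as a root it has a sign, which
makes `x` and `y` comparable. Connectedness makes all lengths equal, so this contradicts the
antichain condition and the half-space criterion applies. -/
theorem linearIndepOn_of_simplyLaced (h : NormalizedSystem B N len) (hc : IsConnectedForm B)
    (hb : ∀ i j, i ≠ j → B (Pi.single i 1) (Pi.single j 1) = 0 ∨
      B (Pi.single i 1) (Pi.single j 1) = -1 ∧ len (Pi.single i 1) = len (Pi.single j 1))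
    {Λ : Set (ι → ℝ)} (hN : Λ ⊆ N) (h0 : ∀ x ∈ Λ, 0 ≤ x) (ha : IsLengthAntichain len Λ) :
    LinearIndepOn ℝ id Λ := by
  have hBint : ∀ i j, ∃ k : ℤ, B (Pi.single i 1) (Pi.single j 1) = k := by
    intro i j
    by_cases hij : i = j
    · subst hij; exact ⟨2, by rw [h.single_norm]; norm_num⟩
    · rcases hb i j hij with h1 | h1
      · exact ⟨0, by simp [h1]⟩
      · exact ⟨-1, by simp [h1.1]⟩
  have hBx : ∀ x : ι → ℝ, (∀ i, ∃ k : ℤ, x i = k) → ∀ i, ∃ k : ℤ, B x (Pi.single i 1) = k := by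
    intro x hx i
    choose f hf using hx
    choose g hg using hBint
    refine ⟨∑ j, f j * g i j, ?_⟩
    rw [h.symm, bilin_eq_sum]
    push_cast
    exact Finset.sum_congr rfl fun j _ => by rw [hf, hg]
  have hint : ∀ x ∈ N, 0 ≤ x → ∀ i, ∃ k : ℤ, x i = k := by
    refine h.positive_induction _ (fun i j => ?_) fun i x _ _ _ hP j => ?_
    · by_cases hij : j = i
      · subst hij; exact ⟨1, by simp⟩
      · exact ⟨0, by simp [hij]⟩
    · by_cases hij : j = i
      · subst hij
        obtain ⟨k, hk⟩ := hBx x hP j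
        obtain ⟨l, hl⟩ := hP j
        exact ⟨l - k, by simp [hk, hl]⟩
      · obtain ⟨l, hl⟩ := hP j
        exact ⟨l, by simp [hl, hij]⟩
  have hBxy : ∀ x ∈ N, 0 ≤ x → ∀ y ∈ N, 0 ≤ y → ∃ k : ℤ, B x y = k := by
    intro x hx hx0 y hy hy0
    choose f hf using hint y hy hy0
    choose g hg using hBx x (hint x hx hx0)
    refine ⟨∑ i, f i * g i, ?_⟩
    rw [bilin_eq_sum]
    push_cast
    exact Finset.sum_congr rfl fun j _ => by rw [hf, hg]
  have hlen : ∀ x ∈ N, 0 ≤ x → ∀ y ∈ N, 0 ≤ y → len x = len y := by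
    have h1 : ∀ i j, len (Pi.single j 1) = len (Pi.single i 1) := fun i =>
      hc {j | len (Pi.single j 1) = len (Pi.single i 1)} ⟨i, rfl⟩ fun j hj k hk => by
        by_cases hjk : j = k
        · exact hjk ▸ hj
        · rcases hb j k hjk with h2 | h2
          · exact absurd h2 hk
          · exact h2.2.symm.trans hj
    have h2 : ∀ i, ∀ x ∈ N, 0 ≤ x → len x = len (Pi.single i 1) := fun i =>
      h.positive_induction _ (h1 i) fun j x hx _ _ hP => (h.len_refl j x hx).trans hP
    intro x hx hx0 y hy hy0
    obtain ⟨i, -⟩ := h.exists_pos hx hx0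
    rw [h2 i x hx hx0, h2 i y hy hy0]
  refine linearIndepOn_of_nonacute h.pos h0 (fun x hx => h.ne_zero (hN hx)) fun x hx y hy hxy => ?_
  by_contra! hpos
  obtain ⟨k, hk⟩ := hBxy x (hN hx) (h0 x hx) y (hN hy) (h0 y hy)
  have hlt := h.lt_two (hN hx) (hN hy) hxy
  rw [hk] at hpos hlt
  have hk1 : k = 1 := by
    have a1 : 0 < k := by exact_mod_cast hpos
    have a2 : k < 2 := by exact_mod_cast hlt
    omega
  have hmem := h.refl_mem_of_mem y (hN hy) (h0 y hy) x (hN hx)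
  rw [hk, hk1, Int.cast_one, one_smul] at hmem
  have hl := hlen x (hN hx) (h0 x hx) y (hN hy) (h0 y hy)
  rcases h.sign _ hmem with h1 | h1
  · exact ha y hy x hx hxy.symm hl.symm (sub_nonneg.1 h1)
  · exact ha x hx y hy hxy hl (sub_nonpos.1 h1)

/-- This is the recurrence `sin ((k + 2) θ) = 2 cos θ sin ((k + 1) θ) - sin (k θ)`. The two simple
reflections, applied alternately, thus run through the dihedral roots. -/
theorem dihedralRoot_succ (h : NormalizedSystem B N len) {i j : ι} {θ : ℝ}
    (hB : B (Pi.single i 1) (Pi.single j 1) = -(2 * Real.cos θ)) (k : ℕ) :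
    dihedralRoot θ i j (k + 1) = dihedralRoot θ j i k -
      B (dihedralRoot θ j i k) (Pi.single i 1) • Pi.single i (1 : ℝ) := by
  have hB' : B (Pi.single j 1) (Pi.single i 1) = -(2 * Real.cos θ) := by rw [h.symm, hB]
  have ht : Real.sin ((k + 1 + 1) * θ) =
      2 * Real.cos θ * Real.sin ((k + 1) * θ) - Real.sin (k * θ) := by
    have e1 : ((k : ℝ) + 1 + 1) * θ = (k + 1) * θ + θ := by ring
    have e2 : (k : ℝ) * θ = (k + 1) * θ - θ := by ring
    rw [e1, e2, Real.sin_add, Real.sin_sub]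
    ring
  simp only [dihedralRoot, map_smul, map_add, LinearMap.add_apply, LinearMap.smul_apply, smul_eq_mul,
    hB', h.single_norm, Nat.cast_add, Nat.cast_one, ht]
  module

theorem dihedralRoot_refl (h : NormalizedSystem B N len) {i j : ι} {θ : ℝ}
    (hB : B (Pi.single i 1) (Pi.single j 1) = -(2 * Real.cos θ)) (k : ℕ) :
    dihedralRoot θ i j (k + 1) -
      B (dihedralRoot θ i j (k + 1)) (Pi.single i 1) • Pi.single i (1 : ℝ) =
      dihedralRoot θ j i k := by
  rw [h.dihedralRoot_succ hB k, h.refl_refl]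

theorem dihedralRoot_mem (h : NormalizedSystem B N len) {i j : ι} {θ : ℝ}
    (hB : B (Pi.single i 1) (Pi.single j 1) = -(2 * Real.cos θ)) (hs : Real.sin θ ≠ 0) (k : ℕ) :
    (dihedralRoot θ i j k ∈ N ∧ dihedralRoot θ j i k ∈ N) ∧
    len (dihedralRoot θ i j k) = (if Even k then len (Pi.single i 1) else len (Pi.single j 1)) ∧
    len (dihedralRoot θ j i k) =
      (if Even k then len (Pi.single j 1) else len (Pi.single i 1)) := by
  have hB' : B (Pi.single j 1) (Pi.single i 1) = -(2 * Real.cos θ) := by rw [h.symm, hB]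
  induction k with
  | zero => simp [dihedralRoot, smul_smul, hs, h.single_mem]
  | succ k ih =>
    obtain ⟨⟨h1, h2⟩, h3, h4⟩ := ih
    rw [h.dihedralRoot_succ hB k, h.dihedralRoot_succ hB' k]
    refine ⟨⟨h.refl_mem i _ h2, h.refl_mem j _ h1⟩, ?_, ?_⟩
    · rw [h.len_refl i _ h2, h4]
      by_cases hk : Even k <;> simp [hk, Nat.even_add_one]
    · rw [h.len_refl j _ h1, h3]
      by_cases hk : Even k <;> simp [hk, Nat.even_add_one]

/-- The angle between two simple roots is `π - π / m` for some `m ≥ 2`, and the two simple roots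
have the same length if `m` is odd. -/
theorem exists_bond (h : NormalizedSystem B N len) {i j : ι} (hij : i ≠ j) :
    ∃ m : ℕ, 2 ≤ m ∧ B (Pi.single i 1) (Pi.single j 1) = -(2 * Real.cos (Real.pi / m)) ∧
      (Odd m → len (Pi.single i 1) = len (Pi.single j 1)) := by
  set c := -B (Pi.single i 1) (Pi.single j 1) / 2 with hc
  have hc0 : 0 ≤ c := by
    have := h.single_nonpos hij
    rw [hc]; linarith
  have hc1 : c < 1 := by
    have := h.pos (Pi.single i 1 + Pi.single j 1) (fun he => by
      have := congrFun he i
      simp [hij] at this)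
    simp only [map_add, LinearMap.add_apply, h.single_norm,
      h.symm (Pi.single j 1) (Pi.single i 1)] at this
    rw [hc]; linarith
  set θ := Real.arccos c with hθ
  have hcos : Real.cos θ = c := Real.cos_arccos (by linarith) hc1.le
  have hB : B (Pi.single i 1) (Pi.single j 1) = -(2 * Real.cos θ) := by
    rw [hcos, hc]; ring
  have hθ0 : 0 < θ := Real.arccos_pos.2 hc1
  have hθ1 : θ ≤ Real.pi / 2 := Real.arccos_le_pi_div_two.2 hc0
  have hs : 0 < Real.sin θ := Real.sin_pos_of_pos_of_lt_pi hθ0 (by linarith [Real.pi_pos])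
  -- With this choice `(m - 1) θ < π ≤ m θ`. If the second inequality were strict, the dihedral root
  -- of index `m - 1` would have coordinates of both signs.
  set m := ⌈Real.pi / θ⌉₊ with hm
  have hm1 : Real.pi ≤ m * θ := by
    have := Nat.le_ceil (Real.pi / θ)
    rwa [div_le_iff₀ hθ0] at this
  have hm2 : m * θ < Real.pi + θ := by
    have := Nat.ceil_lt_add_one (a := Real.pi / θ) (by positivity)
    rw [← hm] at this
    have h2 : (m : ℝ) * θ < (Real.pi / θ + 1) * θ := mul_lt_mul_of_pos_right this hθ0
    have h3 : (Real.pi / θ + 1) * θ = Real.pi + θ := by field_simp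
    linarith
  have hm3 : 2 ≤ m := by
    by_contra! hlt
    have : (m : ℝ) ≤ 1 := by exact_mod_cast Nat.lt_succ_iff.1 hlt
    nlinarith [Real.pi_pos]
  obtain ⟨n, hn⟩ : ∃ n, m = n + 1 := ⟨m - 1, by omega⟩
  have hn1 : (m : ℝ) = n + 1 := by exact_mod_cast hn
  obtain ⟨⟨hmem, -⟩, hlen, -⟩ := h.dihedralRoot_mem hB hs.ne' n
  have hn0 : (1 : ℝ) ≤ n := by exact_mod_cast (by omega : 1 ≤ n)
  have hsn : 0 < Real.sin (n * θ) :=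
    Real.sin_pos_of_pos_of_lt_pi (by positivity) (by rw [hn1] at hm2; linarith)
  have hmθ : m * θ = Real.pi := by
    by_contra hne
    have hlt : Real.pi < m * θ := lt_of_le_of_ne hm1 (Ne.symm hne)
    have hneg : Real.sin (m * θ) < 0 := by
      rw [← neg_pos, ← Real.sin_sub_pi]
      exact Real.sin_pos_of_pos_of_lt_pi (by linarith) (by linarith [Real.pi_pos])
    rw [hn1] at hneg
    have e1 : dihedralRoot θ i j n i = (Real.sin θ)⁻¹ * Real.sin ((n + 1) * θ) := by
      simp [dihedralRoot, hij]
    have e2 : dihedralRoot θ i j n j = (Real.sin θ)⁻¹ * Real.sin (n * θ) := by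
      simp [dihedralRoot, hij.symm]
    rcases h.sign _ hmem with h1 | h1
    · have := h1 i
      rw [e1] at this
      have h5 : (Real.sin θ)⁻¹ * Real.sin ((n + 1) * θ) < 0 :=
        mul_neg_of_pos_of_neg (inv_pos.2 hs) hneg
      exact absurd this (not_le.2 h5)
    · have := h1 j
      rw [e2] at this
      have h5 : 0 < (Real.sin θ)⁻¹ * Real.sin (n * θ) := by positivity
      exact absurd this (not_le.2 h5)
  have hθm : θ = Real.pi / m := by
    rw [eq_div_iff (by positivity)]; linarith
  refine ⟨m, hm3, by rw [← hθm, hB], fun hodd => ?_⟩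
  have hev : Even n := by
    rw [hn] at hodd
    exact (Nat.odd_add_one.1 hodd) |> Nat.not_odd_iff_even.1
  -- For odd `m`, the root of even index `m - 1` has the length of simple root `i` but equals simple
  -- root `j`.
  have e3 : dihedralRoot θ i j n = Pi.single j 1 := by
    have a1 : ((n : ℝ) + 1) * θ = Real.pi := by rw [← hn1, hmθ]
    have a2 : (n : ℝ) * θ = Real.pi - θ := by linarith
    rw [dihedralRoot, a1, a2, Real.sin_pi, Real.sin_pi_sub, zero_smul, zero_add, smul_smul,
      inv_mul_cancel₀ hs.ne', one_smul]
  rw [e3, if_pos hev] at hlen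
  exact hlen.symm

theorem bond_cases (h : NormalizedSystem B N len) {i j : ι} (hij : i ≠ j) :
    B (Pi.single i 1) (Pi.single j 1) = 0 ∨
    (B (Pi.single i 1) (Pi.single j 1) = -1 ∧ len (Pi.single i 1) = len (Pi.single j 1)) ∨
    B (Pi.single i 1) (Pi.single j 1) = -√2 ∨
    (B (Pi.single i 1) (Pi.single j 1) = -Real.goldenRatio ∧
      len (Pi.single i 1) = len (Pi.single j 1)) ∨
    B (Pi.single i 1) (Pi.single j 1) ≤ -√3 := by
  obtain ⟨m, hm, hB, hl⟩ := h.exists_bond hij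
  rcases (by omega : m = 2 ∨ m = 3 ∨ m = 4 ∨ m = 5 ∨ 6 ≤ m) with rfl | rfl | rfl | rfl | h6
  · left; rw [hB]; simp
  · right; left
    exact ⟨by rw [hB]; simp, hl (by decide)⟩
  · right; right; left
    rw [hB]; simp; ring
  · right; right; right; left
    refine ⟨?_, hl (by decide)⟩
    rw [hB]; simp [Real.goldenRatio]; ring
  · right; right; right; right
    rw [hB]
    have : Real.cos (Real.pi / 6) ≤ Real.cos (Real.pi / m) := by
      have h6' : (6 : ℝ) ≤ m := by exact_mod_cast h6
      apply Real.cos_le_cos_of_nonneg_of_le_pi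
      · positivity
      · linarith [Real.pi_pos]
      · gcongr
    rw [Real.cos_pi_div_six] at this
    linarith

theorem linearIndepOn_pair (h : NormalizedSystem B N len) {x y : ι → ℝ} (hx : x ∈ N) (hx0 : 0 ≤ x)
    (hy : y ∈ N) (hy0 : 0 ≤ y) (hxy : x ≠ y) : LinearIndepOn ℝ id {x, y} := by
  rw [LinearIndepOn.pair_iff _ hxy]
  intro a b hab
  have ha : a = 0 := by
    by_contra hne
    have h1 : x = (-b / a) • y := by
      have h2 : a • x = -b • y := by
        rw [neg_smul]; exact eq_neg_of_add_eq_zero_left hab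
      rw [div_eq_inv_mul, mul_smul, ← h2, smul_smul, inv_mul_cancel₀ hne, one_smul]
    rcases le_total 0 (-b / a) with hc | hc
    · exact hxy (h.eq_of_smul hx hy hc h1)
    · have h3 : x ≤ 0 := by
        rw [h1]; exact smul_nonpos_of_nonpos_of_nonneg hc hy0
      exact h.ne_zero hx (le_antisymm h3 hx0)
  refine ⟨ha, ?_⟩
  rw [ha, zero_smul, zero_add] at hab
  exact (smul_eq_zero.1 hab).resolve_right (h.ne_zero hy)

end NormalizedSystem

/-! ### Rank two -/

theorem sin_mul_le_sin_mul {m a b : ℕ} (hm : 0 < m) (hab : a ≤ b) (h : a + b ≤ m) :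
    Real.sin (a * (Real.pi / m)) ≤ Real.sin (b * (Real.pi / m)) := by
  have hm' : (0 : ℝ) < m := by exact_mod_cast hm
  have hab' : (a : ℝ) ≤ b := by exact_mod_cast hab
  have h' : (a : ℝ) + b ≤ m := by exact_mod_cast h
  have hp := Real.pi_pos
  have ht : 0 < Real.pi / m := by positivity
  have hmt : m * (Real.pi / m) = Real.pi := by field_simp
  have h1 : (a + b) * (Real.pi / m) ≤ Real.pi := by
    exact (mul_le_mul_of_nonneg_right h' ht.le).trans hmt.le
  have h2 : a * (Real.pi / m) ≤ b * (Real.pi / m) := mul_le_mul_of_nonneg_right hab' ht.le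
  have h3 : 0 ≤ a * (Real.pi / m) := by positivity
  rw [← sub_nonneg, Real.sin_sub_sin]
  refine mul_nonneg (mul_nonneg zero_le_two (Real.sin_nonneg_of_nonneg_of_le_pi ?_ ?_))
    (Real.cos_nonneg_of_neg_pi_div_two_le_of_le ?_ ?_) <;> nlinarith

theorem sin_mul_le_sin_mul' {m a b : ℕ} (hm : 0 < m) (hab : a ≤ b) (hb : b ≤ m) (h : m ≤ a + b) :
    Real.sin (b * (Real.pi / m)) ≤ Real.sin (a * (Real.pi / m)) := by
  have key : ∀ c : ℕ, c ≤ m →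
      Real.sin (c * (Real.pi / m)) = Real.sin ((m - c : ℕ) * (Real.pi / m)) := by
    intro c hc
    have hm' : (m : ℝ) ≠ 0 := by exact_mod_cast hm.ne'
    rw [Nat.cast_sub hc, ← Real.sin_pi_sub]
    congr 1
    field_simp
  rw [key b hb, key a (hab.trans hb)]
  exact sin_mul_le_sin_mul hm (by omega) (by omega)

namespace NormalizedSystem

set_option linter.unusedSectionVars false

variable {ι : Type*} [Fintype ι] [DecidableEq ι] {B : LinearMap.BilinForm ℝ (ι → ℝ)}
  {N : Set (ι → ℝ)} {len : (ι → ℝ) → ℝ}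

/-- Reading the list of roots from the other simple root reverses it, because `sin (π - x) = sin x`.
-/
theorem dihedralRoot_swap {m : ℕ} (hm : 2 ≤ m) (i j : ι) {k : ℕ} (hk : k < m) :
    dihedralRoot (Real.pi / m) j i k = dihedralRoot (Real.pi / m) i j (m - 1 - k) := by
  have hm' : (m : ℝ) ≠ 0 := by positivity
  have e1 : ((m - 1 - k : ℕ) : ℝ) = m - 1 - k := by
    rw [Nat.cast_sub (by omega), Nat.cast_sub (by omega), Nat.cast_one]
  have e2 : Real.sin (((m - 1 - k : ℕ) + 1) * (Real.pi / m)) = Real.sin (k * (Real.pi / m)) := by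
    rw [e1, ← Real.sin_pi_sub]
    congr 1
    field_simp
    ring
  have e3 : Real.sin ((m - 1 - k : ℕ) * (Real.pi / m)) =
      Real.sin ((k + 1) * (Real.pi / m)) := by
    rw [e1, ← Real.sin_pi_sub]
    congr 1
    field_simp
    ring
  rw [dihedralRoot, dihedralRoot, e2, e3, add_comm]

theorem dihedralRoot_zero {m : ℕ} (hm : 2 ≤ m) (i j : ι) :
    dihedralRoot (Real.pi / m) i j 0 = Pi.single i 1 := by
  have hs : 0 < Real.sin (Real.pi / m) := by
    have : (2 : ℝ) ≤ m := by exact_mod_cast hm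
    apply Real.sin_pos_of_pos_of_lt_pi (by positivity)
    exact div_lt_self Real.pi_pos (by linarith)
  simp [dihedralRoot, smul_smul, hs.ne']

theorem exists_dihedralRoot (h : NormalizedSystem B N len) {i j : ι} (hij : i ≠ j)
    (hι : ∀ k, k = i ∨ k = j) {m : ℕ} (hm : 2 ≤ m)
    (hB : B (Pi.single i 1) (Pi.single j 1) = -(2 * Real.cos (Real.pi / m))) :
    ∀ x ∈ N, 0 ≤ x → ∃ k < m, x = dihedralRoot (Real.pi / m) i j k := by
  have hB' : B (Pi.single j 1) (Pi.single i 1) = -(2 * Real.cos (Real.pi / m)) := by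
    rw [h.symm, hB]
  have hj : dihedralRoot (Real.pi / m) i j (m - 1) = Pi.single j 1 := by
    have := dihedralRoot_swap hm i j (k := 0) (by omega)
    rw [dihedralRoot_zero hm] at this
    exact this.symm
  refine h.positive_induction _ (fun l => ?_) fun l x _ _ hne hP => ?_
  · rcases hι l with rfl | rfl
    · exact ⟨0, by omega, (dihedralRoot_zero hm _ _).symm⟩
    · exact ⟨m - 1, by omega, hj.symm⟩
  · obtain ⟨k, hk, rfl⟩ := hP
    rcases hι l with rfl | rfl
    · obtain _ | k := k
      · exact absurd (dihedralRoot_zero hm _ _) hne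
      · rw [h.dihedralRoot_refl hB]
        exact ⟨m - 1 - k, by omega, dihedralRoot_swap hm _ _ (by omega)⟩
    · have hk' : k ≠ m - 1 := by
        rintro rfl
        exact hne hj
      have := dihedralRoot_swap hm l i hk
      rw [this, (by omega : m - 1 - k = (m - 2 - k) + 1), h.dihedralRoot_refl hB']
      exact ⟨m - 2 - k, by omega, rfl⟩

/-- Both coordinates are sines of multiples of `π / m`, unimodal with peak at `π / 2`. The only
index sum left open is `a + b = m - 1`, where the two coordinates can move in opposite directions.
-/
theorem dihedralRoot_le {m : ℕ} (hm : 2 ≤ m) {i j : ι} (hij : i ≠ j)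
    (hι : ∀ k, k = i ∨ k = j) {a b : ℕ} (hab : a < b) (hb : b < m) :
    (a + b + 2 ≤ m → dihedralRoot (Real.pi / m) i j a ≤ dihedralRoot (Real.pi / m) i j b) ∧
    (m ≤ a + b → dihedralRoot (Real.pi / m) i j b ≤ dihedralRoot (Real.pi / m) i j a) := by
  have hs : 0 < Real.sin (Real.pi / m) := by
    have : (2 : ℝ) ≤ m := by exact_mod_cast hm
    apply Real.sin_pos_of_pos_of_lt_pi (by positivity)
    exact div_lt_self Real.pi_pos (by linarith)
  have e1 : ∀ k, dihedralRoot (Real.pi / m) i j k i =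
      (Real.sin (Real.pi / m))⁻¹ * Real.sin ((k + 1 : ℕ) * (Real.pi / m)) := by
    intro k; simp [dihedralRoot, hij]
  have e2 : ∀ k, dihedralRoot (Real.pi / m) i j k j =
      (Real.sin (Real.pi / m))⁻¹ * Real.sin (k * (Real.pi / m)) := by
    intro k; simp [dihedralRoot, hij.symm]
  constructor
  · intro hle k
    rcases hι k with rfl | rfl
    · rw [e1, e1]
      exact mul_le_mul_of_nonneg_left
        (sin_mul_le_sin_mul (by omega) (by omega) (by omega)) (inv_nonneg.2 hs.le)
    · rw [e2, e2]
      exact mul_le_mul_of_nonneg_left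
        (sin_mul_le_sin_mul (by omega) (by omega) (by omega)) (inv_nonneg.2 hs.le)
  · intro hle k
    rcases hι k with rfl | rfl
    · rw [e1, e1]
      exact mul_le_mul_of_nonneg_left
        (sin_mul_le_sin_mul' (by omega) (by omega) (by omega) (by omega)) (inv_nonneg.2 hs.le)
    · rw [e2, e2]
      exact mul_le_mul_of_nonneg_left
        (sin_mul_le_sin_mul' (by omega) (by omega) (by omega) (by omega)) (inv_nonneg.2 hs.le)

/-- Distinct members of equal length must have indices with sum `m - 1`. For odd `m` all lengths
agree, so an index has only one possible partner. For even `m` the parity of the index fixes the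
length, and two indices of equal parity cannot have the odd sum `m - 1`. Hence there are at most two
elements. -/
theorem linearIndepOn_of_rank_two (h : NormalizedSystem B N len) {i j : ι} (hij : i ≠ j)
    (hι : ∀ k, k = i ∨ k = j) {Λ : Set (ι → ℝ)} (hN : Λ ⊆ N) (h0 : ∀ x ∈ Λ, 0 ≤ x)
    (ha : IsLengthAntichain len Λ) : LinearIndepOn ℝ id Λ := by
  obtain ⟨m, hm, hB, hodd⟩ := h.exists_bond hij
  have hs : 0 < Real.sin (Real.pi / m) := by
    have : (2 : ℝ) ≤ m := by exact_mod_cast hm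
    apply Real.sin_pos_of_pos_of_lt_pi (by positivity)
    exact div_lt_self Real.pi_pos (by linarith)
  have hlen := fun k => (h.dihedralRoot_mem hB hs.ne' k).2.1
  have hidx : ∀ x ∈ Λ, ∃ k < m, x = dihedralRoot (Real.pi / m) i j k := fun x hx =>
    h.exists_dihedralRoot hij hι hm hB x (hN hx) (h0 x hx)
  have key : ∀ a b, a < m → b < m → dihedralRoot (Real.pi / m) i j a ∈ Λ →
      dihedralRoot (Real.pi / m) i j b ∈ Λ →
      dihedralRoot (Real.pi / m) i j a ≠ dihedralRoot (Real.pi / m) i j b →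
      (Odd m ∨ (Even a ↔ Even b)) → a + b + 1 = m := by
    have key' : ∀ a b, a < b → b < m → dihedralRoot (Real.pi / m) i j a ∈ Λ →
        dihedralRoot (Real.pi / m) i j b ∈ Λ →
        dihedralRoot (Real.pi / m) i j a ≠ dihedralRoot (Real.pi / m) i j b →
        (Odd m ∨ (Even a ↔ Even b)) → a + b + 1 = m := by
      intro a b hab hb hxa hxb hne hpar
      have hl : len (dihedralRoot (Real.pi / m) i j a) =
          len (dihedralRoot (Real.pi / m) i j b) := by
        rw [hlen, hlen]
        rcases hpar with hp | hp
        · rw [hodd hp]; simp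
        · simp [hp]
      by_contra hne'
      rcases (by omega : a + b + 2 ≤ m ∨ m ≤ a + b) with h1 | h1
      · exact ha _ hxa _ hxb hne hl ((dihedralRoot_le hm hij hι hab hb).1 h1)
      · exact ha _ hxb _ hxa hne.symm hl.symm ((dihedralRoot_le hm hij hι hab hb).2 h1)
    intro a b haa hbb hxa hxb hne hpar
    rcases lt_trichotomy a b with hab | hab | hab
    · exact key' a b hab hbb hxa hxb hne hpar
    · exact absurd (by rw [hab]) hne
    · have := key' b a hab haa hxb hxa hne.symm (hpar.imp id Iff.symm)
      omega
  have htwo : ∀ x ∈ Λ, ∀ y ∈ Λ, ∀ z ∈ Λ, x ≠ y → x ≠ z → y ≠ z → False := by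
    intro x hx y hy z hz hxy hxz hyz
    obtain ⟨a, haa, rfl⟩ := hidx x hx
    obtain ⟨b, hbb, rfl⟩ := hidx y hy
    obtain ⟨c, hcc, rfl⟩ := hidx z hz
    rcases Nat.even_or_odd m with hme | hmo
    · have hpar : (Even a ↔ Even b) ∨ (Even a ↔ Even c) ∨ (Even b ↔ Even c) := by tauto
      rw [Nat.even_iff] at hme
      simp only [Nat.even_iff] at hpar key
      rcases hpar with hp | hp | hp
      · have := key a b haa hbb hx hy hxy (Or.inr hp); omega
      · have := key a c haa hcc hx hz hxz (Or.inr hp); omega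
      · have := key b c hbb hcc hy hz hyz (Or.inr hp); omega
    · have h1 := key a b haa hbb hx hy hxy (Or.inl hmo)
      have h2 := key a c haa hcc hx hz hxz (Or.inl hmo)
      exact hyz (by rw [(by omega : b = c)])
  by_cases hsub : Λ.Subsingleton
  · rcases hsub.eq_empty_or_singleton with rfl | ⟨x, rfl⟩
    · exact linearIndepOn_empty _ _
    · exact (linearIndepOn_singleton_iff ℝ).2 (h.ne_zero (hN rfl))
  · obtain ⟨x, hx, y, hy, hxy⟩ := Set.not_subsingleton_iff.1 hsub
    refine (h.linearIndepOn_pair (hN hx) (h0 x hx) (hN hy) (h0 y hy) hxy).mono fun z hz => ?_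
    by_contra hcon
    simp only [Set.mem_insert_iff, Set.mem_singleton_iff, not_or] at hcon
    exact htwo x hx y hy z hz hxy (Ne.symm hcon.1) (Ne.symm hcon.2)

end NormalizedSystem

/-! ### Exact arithmetic with the golden ratio -/

/-- A pair `(a, b)` stands for the number `a + b φ`, `φ` being the golden ratio. -/
abbrev GoldenInt := ℤ × ℤ

namespace GoldenInt

noncomputable def val (z : GoldenInt) : ℝ := z.1 + z.2 * Real.goldenRatio

def mul (z w : GoldenInt) : GoldenInt :=
  (z.1 * w.1 + z.2 * w.2, z.1 * w.2 + z.2 * w.1 + z.2 * w.2)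

def sub (z w : GoldenInt) : GoldenInt := (z.1 - w.1, z.2 - w.2)

/-- A sufficient condition for nonnegativity, from `1.618 < φ < 1.6181`. -/
def nonneg (z : GoldenInt) : Bool :=
  decide (0 ≤ 1000 * z.1 + 1618 * z.2) && decide (0 ≤ 10000 * z.1 + 16181 * z.2)

theorem val_mul (z w : GoldenInt) : val (mul z w) = val z * val w := by
  have := Real.goldenRatio_sq
  simp only [val, mul]
  push_cast
  linear_combination (-(z.2 : ℝ) * w.2) * this

theorem val_sub (z w : GoldenInt) : val (sub z w) = val z - val w := by
  simp only [val, sub]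
  push_cast
  ring

theorem val_zero : val (0, 0) = 0 := by simp [val]

theorem val_one : val (1, 0) = 1 := by simp [val]

/-- Irrationality of `φ` makes the representation unique, so vanishing of pivots can be decided on
integer pairs. -/
theorem val_eq_zero {z : GoldenInt} (h : val z = 0) : z = (0, 0) := by
  have h2 : z.2 = 0 := by
    by_contra hne
    have hne' : (z.2 : ℝ) ≠ 0 := by exact_mod_cast hne
    refine Real.goldenRatio_irrational ⟨-z.1 / z.2, ?_⟩
    push_cast
    rw [div_eq_iff hne']
    simp only [val] at h
    linarith
  have h1 : z.1 = 0 := by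
    simp only [val, h2] at h
    simpa using h
  exact Prod.ext h1 h2

theorem goldenRatio_bounds : 1.618 < Real.goldenRatio ∧ Real.goldenRatio < 1.6181 := by
  have h1 : (2.236 : ℝ) < √5 := Real.lt_sqrt_of_sq_lt (by norm_num)
  have h2 : √5 < (2.2362 : ℝ) := (Real.sqrt_lt' (by norm_num)).2 (by norm_num)
  constructor <;> simp only [Real.goldenRatio] <;> linarith

theorem val_nonneg {z : GoldenInt} (h : nonneg z = true) : 0 ≤ val z := by
  simp only [nonneg, Bool.and_eq_true, decide_eq_true_eq] at h
  have h1 : (0 : ℝ) ≤ 1000 * z.1 + 1618 * z.2 := by exact_mod_cast h.1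
  have h2 : (0 : ℝ) ≤ 10000 * z.1 + 16181 * z.2 := by exact_mod_cast h.2
  obtain ⟨b1, b2⟩ := goldenRatio_bounds
  simp only [val]
  rcases le_total (0 : ℝ) z.2 with h3 | h3 <;> nlinarith

end GoldenInt

/-! ### Root tables and the search through antichains -/

abbrev GoldenVec := GoldenInt × GoldenInt × GoldenInt × GoldenInt

namespace GoldenVec

open GoldenInt

def coord (v : GoldenVec) : Fin 4 → GoldenInt
  | 0 => v.1
  | 1 => v.2.1
  | 2 => v.2.2.1
  | 3 => v.2.2.2

noncomputable def eval (v : GoldenVec) : Fin 4 → ℝ := fun i => val (coord v i)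

def single : Fin 4 → GoldenVec
  | 0 => ((1, 0), (0, 0), (0, 0), (0, 0))
  | 1 => ((0, 0), (1, 0), (0, 0), (0, 0))
  | 2 => ((0, 0), (0, 0), (1, 0), (0, 0))
  | 3 => ((0, 0), (0, 0), (0, 0), (1, 0))

/-- The combination `w_p v - v_p w`, which vanishes at the coordinate `p`. -/
def eliminate (p : Fin 4) (w v : GoldenVec) : GoldenVec :=
  let a := coord w p
  let b := coord v p
  (sub (mul a v.1) (mul b w.1), sub (mul a v.2.1) (mul b w.2.1),
    sub (mul a v.2.2.1) (mul b w.2.2.1), sub (mul a v.2.2.2) (mul b w.2.2.2))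

theorem eval_eliminate (p : Fin 4) (w v : GoldenVec) :
    eval (eliminate p w v) = eval w p • eval v - eval v p • eval w := by
  funext i
  fin_cases i <;>
    simp [eval, eliminate, coord, val_sub, val_mul]

def dot (v w : GoldenVec) : GoldenInt :=
  sub (sub (mul v.1 w.1) (sub (0, 0) (mul v.2.1 w.2.1)))
    (sub (sub (0, 0) (mul v.2.2.1 w.2.2.1)) (mul v.2.2.2 w.2.2.2))

theorem val_dot (v w : GoldenVec) : val (dot v w) = ∑ i, eval v i * eval w i := by
  simp only [dot, val_sub, val_mul, val_zero, Fin.sum_univ_four, eval, coord]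
  ring

/-- The simple reflection with index `i` for the Cartan matrix with rows `C`. -/
def reflect (C : Fin 4 → GoldenVec) (i : Fin 4) (v : GoldenVec) : GoldenVec :=
  let d := dot (C i) v
  match i with
  | 0 => (sub v.1 d, v.2.1, v.2.2.1, v.2.2.2)
  | 1 => (v.1, sub v.2.1 d, v.2.2.1, v.2.2.2)
  | 2 => (v.1, v.2.1, sub v.2.2.1 d, v.2.2.2)
  | 3 => (v.1, v.2.1, v.2.2.1, sub v.2.2.2 d)

theorem eval_reflect (C : Fin 4 → GoldenVec) (i j : Fin 4) (v : GoldenVec) :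
    eval (reflect C i v) j = eval v j - if j = i then ∑ k, eval (C i) k * eval v k else 0 := by
  rw [← val_dot]
  fin_cases i <;> fin_cases j <;> simp [eval, reflect, coord, val_sub]

theorem coord_reflect_of_ne (C : Fin 4 → GoldenVec) {i j : Fin 4} (h : j ≠ i) (v : GoldenVec) :
    coord (reflect C i v) j = coord v j := by
  fin_cases i <;> fin_cases j <;> first | rfl | exact absurd rfl h

theorem coord_single (i j : Fin 4) : coord (single i) j = if j = i then (1, 0) else (0, 0) := by
  fin_cases i <;> fin_cases j <;> rfl

def leading (v : GoldenVec) : Option (Fin 4) :=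
  if v.1 ≠ (0, 0) then some 0 else if v.2.1 ≠ (0, 0) then some 1 else
    if v.2.2.1 ≠ (0, 0) then some 2 else if v.2.2.2 ≠ (0, 0) then some 3 else none

theorem eval_ne_zero_of_leading {v : GoldenVec} {p : Fin 4} (h : leading v = some p) :
    eval v p ≠ 0 := by
  intro h0
  have h1 := val_eq_zero h0
  unfold leading at h
  split_ifs at h with a1 a2 a3 a4 <;> cases h <;> simp_all [coord]

def reduce (piv : List (Fin 4 × GoldenVec)) (v : GoldenVec) : GoldenVec :=
  piv.foldl (fun v q => eliminate q.1 q.2 v) v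

/-- Comparison of two marked vectors with equal marks; a sufficient condition. -/
def le (c d : Bool × GoldenVec) : Bool :=
  c.1 == d.1 && nonneg (sub d.2.1 c.2.1) && nonneg (sub d.2.2.1 c.2.2.1) &&
    nonneg (sub d.2.2.2.1 c.2.2.2.1) && nonneg (sub d.2.2.2.2 c.2.2.2.2)

theorem eval_le_of_le {c d : Bool × GoldenVec} (h : le c d = true) :
    c.1 = d.1 ∧ eval c.2 ≤ eval d.2 := by
  simp only [le, Bool.and_eq_true, beq_iff_eq] at h
  obtain ⟨⟨⟨⟨h0, h1⟩, h2⟩, h3⟩, h4⟩ := h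
  refine ⟨h0, fun i => ?_⟩
  rw [← sub_nonneg]
  simp only [eval]
  rw [← val_sub]
  fin_cases i
  · exact val_nonneg h1
  · exact val_nonneg h2
  · exact val_nonneg h3
  · exact val_nonneg h4

def incomparable (c d : Bool × GoldenVec) : Bool := !(le c d || le d c)

/-- Checks that all antichains of the list `cs` are linearly independent modulo the echelon
system `piv`, by a depth-first search with Gaussian elimination. -/
def antichainsIndependent :
    ℕ → List (Bool × GoldenVec) → List (Fin 4 × GoldenVec) → Bool
  | 0, cs, _ => cs.isEmpty
  | _ + 1, [], _ => true
  | n + 1, c :: cs, piv =>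
    antichainsIndependent n cs piv &&
      (let w := reduce piv c.2
       match leading w with
       | none => false
       | some p => antichainsIndependent n (cs.filter (incomparable c)) (piv ++ [(p, w)]))

/-- A simple root under its own reflection is exempt, since it becomes negative. Marks are
preserved, as lengths are. -/
def closedUnderReflections (C : Fin 4 → GoldenVec) (L : List (Bool × GoldenVec)) : Bool :=
  L.all fun c => [0, 1, 2, 3].all fun i =>
    decide (c.2 = single i) || L.contains (c.1, reflect C i c.2)

/-- The positive roots of the Coxeter group `H₄`. -/
def typeHPositiveRoots : List (Bool × GoldenVec) :=
  [(true, (1, 0), (0, 0), (0, 0), (0, 0)), (true, (0, 0), (1, 0), (0, 0), (0, 0)),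
   (true, (0, 0), (0, 0), (1, 0), (0, 0)), (true, (0, 0), (0, 0), (0, 0), (1, 0)),
   (true, (1, 0), (0, 1), (0, 0), (0, 0)), (true, (0, 1), (1, 0), (0, 0), (0, 0)),
   (true, (0, 0), (1, 0), (1, 0), (0, 0)), (true, (0, 0), (0, 0), (1, 0), (1, 0)),
   (true, (0, 1), (0, 1), (0, 0), (0, 0)), (true, (1, 0), (0, 1), (0, 1), (0, 0)),
   (true, (0, 1), (1, 0), (1, 0), (0, 0)), (true, (0, 0), (1, 0), (1, 0), (1, 0)),
   (true, (0, 1), (0, 1), (0, 1), (0, 0)), (true, (1, 0), (0, 1), (0, 1), (0, 1)),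
   (true, (0, 1), (1, 1), (1, 0), (0, 0)), (true, (0, 1), (1, 0), (1, 0), (1, 0)),
   (true, (0, 1), (1, 1), (0, 1), (0, 0)), (true, (0, 1), (0, 1), (0, 1), (0, 1)),
   (true, (1, 1), (1, 1), (1, 0), (0, 0)), (true, (0, 1), (1, 1), (1, 0), (1, 0)),
   (true, (1, 1), (1, 1), (0, 1), (0, 0)), (true, (0, 1), (1, 1), (0, 1), (0, 1)),
   (true, (1, 1), (1, 1), (1, 0), (1, 0)), (true, (0, 1), (1, 1), (1, 1), (1, 0)),
   (true, (1, 1), (0, 2), (0, 1), (0, 0)), (true, (1, 1), (1, 1), (0, 1), (0, 1)),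
   (true, (0, 1), (1, 1), (1, 1), (0, 1)), (true, (1, 1), (1, 1), (1, 1), (1, 0)),
   (true, (1, 1), (0, 2), (0, 1), (0, 1)), (true, (1, 1), (1, 1), (1, 1), (0, 1)),
   (true, (1, 1), (1, 2), (1, 1), (1, 0)), (true, (1, 1), (0, 2), (0, 2), (0, 1)),
   (true, (1, 1), (1, 2), (1, 1), (0, 1)), (true, (1, 2), (1, 2), (1, 1), (1, 0)),
   (true, (1, 1), (1, 2), (0, 2), (0, 1)), (true, (1, 2), (1, 2), (1, 1), (0, 1)),
   (true, (1, 2), (2, 2), (1, 1), (1, 0)), (true, (1, 2), (1, 2), (0, 2), (0, 1)),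
   (true, (1, 2), (2, 2), (1, 1), (0, 1)), (true, (1, 2), (2, 2), (2, 1), (1, 0)),
   (true, (1, 2), (1, 3), (0, 2), (0, 1)), (true, (1, 2), (2, 2), (1, 2), (0, 1)),
   (true, (1, 2), (2, 2), (2, 1), (1, 1)), (true, (2, 2), (1, 3), (0, 2), (0, 1)),
   (true, (1, 2), (1, 3), (1, 2), (0, 1)), (true, (1, 2), (2, 2), (1, 2), (1, 1)),
   (true, (2, 2), (1, 3), (1, 2), (0, 1)), (true, (1, 2), (1, 3), (1, 2), (1, 1)),
   (true, (2, 2), (2, 3), (1, 2), (0, 1)), (true, (2, 2), (1, 3), (1, 2), (1, 1)),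
   (true, (1, 3), (2, 3), (1, 2), (0, 1)), (true, (2, 2), (2, 3), (1, 2), (1, 1)),
   (true, (1, 3), (2, 3), (1, 2), (1, 1)), (true, (2, 2), (2, 3), (2, 2), (1, 1)),
   (true, (1, 3), (2, 3), (2, 2), (1, 1)), (true, (1, 3), (3, 3), (2, 2), (1, 1)),
   (true, (2, 3), (3, 3), (2, 2), (1, 1)), (true, (2, 3), (2, 4), (2, 2), (1, 1)),
   (true, (2, 3), (2, 4), (1, 3), (1, 1)), (true, (2, 3), (2, 4), (1, 3), (0, 2))]

/-- The positive roots of `F₄`, marked `true` if long. -/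
def typeFPositiveRoots : List (Bool × GoldenVec) :=
  [(true, (1, 0), (0, 0), (0, 0), (0, 0)), (true, (0, 0), (1, 0), (0, 0), (0, 0)),
   (false, (0, 0), (0, 0), (1, 0), (0, 0)), (false, (0, 0), (0, 0), (0, 0), (1, 0)),
   (true, (1, 0), (1, 0), (0, 0), (0, 0)), (true, (0, 0), (1, 0), (2, 0), (0, 0)),
   (false, (0, 0), (1, 0), (1, 0), (0, 0)), (false, (0, 0), (0, 0), (1, 0), (1, 0)),
   (true, (1, 0), (1, 0), (2, 0), (0, 0)), (true, (0, 0), (1, 0), (2, 0), (2, 0)),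
   (false, (1, 0), (1, 0), (1, 0), (0, 0)), (false, (0, 0), (1, 0), (1, 0), (1, 0)),
   (true, (1, 0), (2, 0), (2, 0), (0, 0)), (true, (1, 0), (1, 0), (2, 0), (2, 0)),
   (false, (1, 0), (1, 0), (1, 0), (1, 0)), (false, (0, 0), (1, 0), (2, 0), (1, 0)),
   (true, (1, 0), (2, 0), (2, 0), (2, 0)), (false, (1, 0), (1, 0), (2, 0), (1, 0)),
   (true, (1, 0), (2, 0), (4, 0), (2, 0)), (false, (1, 0), (2, 0), (2, 0), (1, 0)),
   (true, (1, 0), (3, 0), (4, 0), (2, 0)), (false, (1, 0), (2, 0), (3, 0), (1, 0)),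
   (true, (2, 0), (3, 0), (4, 0), (2, 0)), (false, (1, 0), (2, 0), (3, 0), (2, 0))]

def typeHCartan : Fin 4 → GoldenVec
  | 0 => ((2, 0), (0, -1), (0, 0), (0, 0))
  | 1 => ((0, -1), (2, 0), (-1, 0), (0, 0))
  | 2 => ((0, 0), (-1, 0), (2, 0), (-1, 0))
  | 3 => ((0, 0), (0, 0), (-1, 0), (2, 0))

/-- Row `i` lists the pairings of the simple roots with the coroot of root `i`, for crystallographic
coordinates in which roots 0 and 1 are long. -/
def typeFCartan : Fin 4 → GoldenVec
  | 0 => ((2, 0), (-1, 0), (0, 0), (0, 0))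
  | 1 => ((-1, 0), (2, 0), (-1, 0), (0, 0))
  | 2 => ((0, 0), (-2, 0), (2, 0), (-1, 0))
  | 3 => ((0, 0), (0, 0), (-1, 0), (2, 0))

theorem typeH_closed : closedUnderReflections typeHCartan typeHPositiveRoots = true := by
  decide +kernel

theorem typeF_closed : closedUnderReflections typeFCartan typeFPositiveRoots = true := by
  decide +kernel

/-- The table has 24 entries and each call drops at least the head of the list, so 25 levels of
recursion suffice; likewise 61 for the 60 entries of type H. -/
theorem typeF_antichains : antichainsIndependent 25 typeFPositiveRoots [] = true := by
  decide +kernel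

theorem typeH_antichains : antichainsIndependent 61 typeHPositiveRoots [] = true := by
  decide +kernel

end GoldenVec

/-! ### Soundness of the search -/

namespace GoldenVec

open GoldenInt

/-- The pairs in `piv` form an echelon basis of `W`: the elements of `W` are determined by their
coordinates at the pivots, and `reduce piv` clears these coordinates modulo `W`. -/
structure IsEchelon (piv : List (Fin 4 × GoldenVec)) (W : Submodule ℝ (Fin 4 → ℝ)) : Prop where
  eq_zero : ∀ x ∈ W, (∀ q ∈ piv, x q.1 = 0) → x = 0
  reduce_pivot : ∀ v, ∀ q ∈ piv, eval (reduce piv v) q.1 = 0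
  reduce_mod : ∀ v, ∃ a : ℝ, a ≠ 0 ∧ eval (reduce piv v) - a • eval v ∈ W

theorem isEchelon_nil : IsEchelon [] ⊥ where
  eq_zero x hx _ := hx
  reduce_pivot := by simp
  reduce_mod v := ⟨1, one_ne_zero, by simp [reduce]⟩

theorem reduce_append (piv : List (Fin 4 × GoldenVec)) (p : Fin 4) (w v : GoldenVec) :
    reduce (piv ++ [(p, w)]) v = eliminate p w (reduce piv v) := by
  simp [reduce]

theorem IsEchelon.notMem {piv : List (Fin 4 × GoldenVec)} {W : Submodule ℝ (Fin 4 → ℝ)}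
    (h : IsEchelon piv W) {v : GoldenVec} {p : Fin 4} (hp : eval (reduce piv v) p ≠ 0) :
    eval v ∉ W := by
  intro hv
  obtain ⟨a, -, haW⟩ := h.reduce_mod v
  have h1 : eval (reduce piv v) ∈ W := by
    have := W.add_mem haW (W.smul_mem a hv)
    simpa using this
  exact hp (by rw [h.eq_zero _ h1 (h.reduce_pivot v)]; rfl)

theorem IsEchelon.append {piv : List (Fin 4 × GoldenVec)} {W : Submodule ℝ (Fin 4 → ℝ)}
    (h : IsEchelon piv W) {v : GoldenVec} {p : Fin 4} (hp : eval (reduce piv v) p ≠ 0) :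
    IsEchelon (piv ++ [(p, reduce piv v)]) (W ⊔ Submodule.span ℝ {eval v}) := by
  obtain ⟨a, ha0, haW⟩ := h.reduce_mod v
  have hw : eval (reduce piv v) ∈ W ⊔ Submodule.span ℝ {eval v} := by
    have h1 : a • eval v ∈ Submodule.span ℝ {eval v} :=
      Submodule.smul_mem _ _ (Submodule.mem_span_singleton_self _)
    have := Submodule.add_mem_sup haW h1
    simpa using this
  refine ⟨fun x hx hq => ?_, fun u q hq => ?_, fun u => ?_⟩
  · obtain ⟨y, hy, z, hz, rfl⟩ := Submodule.mem_sup.1 hx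
    obtain ⟨b, rfl⟩ := Submodule.mem_span_singleton.1 hz
    set w := eval (reduce piv v) with hwdef
    -- Trade `v` for its reduction `w`, modulo `W`. As `w` vanishes at the old pivots, these kill
    -- the `W`-part; the new pivot then kills the multiple of `w`.
    have h1 : y + b • eval v = (y - (b / a) • (w - a • eval v)) + (b / a) • w := by
      have h2 : (b / a) • (w - a • eval v) = (b / a) • w - b • eval v := by
        rw [smul_sub, smul_smul, div_mul_cancel₀ _ ha0]
      rw [h2]; abel
    have h3 : y - (b / a) • (w - a • eval v) ∈ W := W.sub_mem hy (W.smul_mem _ haW)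
    rw [h1] at hq ⊢
    have h4 : y - (b / a) • (w - a • eval v) = 0 := by
      refine h.eq_zero _ h3 fun q hq' => ?_
      have h5 := hq q (List.mem_append_left _ hq')
      simp only [Pi.add_apply, Pi.smul_apply, hwdef, h.reduce_pivot v q hq', smul_zero,
        add_zero] at h5
      exact h5
    rw [h4, zero_add] at hq ⊢
    have h6 := hq (p, reduce piv v) (by simp)
    simp only [Pi.smul_apply, smul_eq_mul] at h6
    rw [(mul_eq_zero.1 h6).resolve_right hp, zero_smul]
  · rw [reduce_append, eval_eliminate]
    rcases List.mem_append.1 hq with hq | hq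
    · simp [h.reduce_pivot _ q hq]
    · rw [List.mem_singleton] at hq
      subst hq
      simp only [Pi.sub_apply, Pi.smul_apply, smul_eq_mul]
      ring
  · obtain ⟨b, hb0, hbW⟩ := h.reduce_mod u
    refine ⟨eval (reduce piv v) p * b, mul_ne_zero hp hb0, ?_⟩
    rw [reduce_append, eval_eliminate]
    have h1 : eval (reduce piv v) p • eval (reduce piv u) -
        eval (reduce piv u) p • eval (reduce piv v) - (eval (reduce piv v) p * b) • eval u =
        eval (reduce piv v) p • (eval (reduce piv u) - b • eval u) -
          eval (reduce piv u) p • eval (reduce piv v) := by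
      rw [smul_sub, smul_smul]; abel
    rw [h1]
    exact Submodule.sub_mem _
      (Submodule.smul_mem _ _ (Submodule.mem_sup_left hbW)) (Submodule.smul_mem _ _ hw)

/-- Independence is stated modulo a subspace `W`, the span of the vectors chosen so far, so that the
induction can enlarge `W`. If `c` is chosen, the other coefficients vanish modulo `W` plus the line
of `c`; then that of `c` vanishes because `c` is not in `W`. -/
theorem antichainsIndependent_sound (n : ℕ) : ∀ (cs : List (Bool × GoldenVec))
    (piv : List (Fin 4 × GoldenVec)) (W : Submodule ℝ (Fin 4 → ℝ)), IsEchelon piv W →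
    antichainsIndependent n cs piv = true →
    ∀ t : Finset (Bool × GoldenVec), (∀ c ∈ t, c ∈ cs) →
      (∀ c ∈ t, ∀ d ∈ t, c ≠ d → incomparable c d = true) →
      ∀ g : Bool × GoldenVec → ℝ, ∑ c ∈ t, g c • eval c.2 ∈ W → ∀ c ∈ t, g c = 0 := by
  induction n with
  | zero =>
    intro cs piv W _ hs t ht _ g _ c hc
    simp only [antichainsIndependent, List.isEmpty_iff] at hs
    simpa [hs] using ht c hc
  | succ n ih =>
    intro cs piv W hW hs t ht hinc g hg
    rcases cs with _ | ⟨c, cs⟩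
    · intro c hc
      simpa using ht c hc
    simp only [antichainsIndependent, Bool.and_eq_true] at hs
    obtain ⟨hs1, hs2⟩ := hs
    by_cases hct : c ∈ t
    · rcases hl : leading (reduce piv c.2) with _ | p
      · simp [hl] at hs2
      · simp only [hl] at hs2
        have hp := eval_ne_zero_of_leading hl
        have hsum := Finset.sum_erase_add t (fun c => g c • eval c.2) hct
        have h1 := ih _ _ _ (hW.append hp) hs2 (t.erase c) (fun d hd => by
            rw [Finset.mem_erase] at hd
            rw [List.mem_filter]
            refine ⟨(List.mem_cons.1 (ht d hd.2)).resolve_left hd.1, hinc c hct d hd.2 hd.1.symm⟩)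
          (fun d hd e he => hinc d (Finset.mem_of_mem_erase hd) e (Finset.mem_of_mem_erase he)) g
          (by
            have h2 : ∑ d ∈ t.erase c, g d • eval d.2 =
                ∑ d ∈ t, g d • eval d.2 - g c • eval c.2 := eq_sub_of_add_eq hsum
            rw [h2]
            exact Submodule.sub_mem _ (Submodule.mem_sup_left hg)
              (Submodule.mem_sup_right
                (Submodule.smul_mem _ _ (Submodule.mem_span_singleton_self _))))
        have h3 : ∑ d ∈ t.erase c, g d • eval d.2 = 0 :=
          Finset.sum_eq_zero fun d hd => by rw [h1 d hd, zero_smul]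
        rw [h3, zero_add] at hsum
        rw [← hsum] at hg
        have h4 : g c = 0 := by
          by_contra hne
          exact hW.notMem hp ((Submodule.smul_mem_iff _ hne).1 hg)
        intro d hd
        by_cases hdc : d = c
        · rw [hdc, h4]
        · exact h1 d (Finset.mem_erase.2 ⟨hdc, hd⟩)
    · exact ih cs piv W hW hs1 t (fun d hd => (List.mem_cons.1 (ht d hd)).resolve_left
        fun he => hct (he ▸ hd)) hinc g hg

end GoldenVec

/-! ### From tables to root systems -/

open GoldenVec in
/-- If the positive roots of a normalized system are given by a table that passes the check of
antichains, then length antichains are linearly independent. -/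
theorem NormalizedSystem.linearIndepOn_of_table {ι : Type*} [Fintype ι] [DecidableEq ι]
    {B : LinearMap.BilinForm ℝ (ι → ℝ)} {N : Set (ι → ℝ)} {len : (ι → ℝ) → ℝ}
    (h : NormalizedSystem B N len) {e : ι → Fin 4} (he : Function.Injective e)
    {C : Fin 4 → GoldenVec} {L : List (Bool × GoldenVec)}
    (hL : closedUnderReflections C L = true) {n : ℕ} (hn : antichainsIndependent n L [] = true)
    {t : ι → ℝ} (ht : ∀ i, 0 < t i) {s l : Bool → ℝ} (hs : ∀ b, 0 < s b) {f : ι → Bool}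
    (hsimple : ∀ i, (f i, GoldenVec.single (e i)) ∈ L) (hst : ∀ i, s (f i) * t i = 1)
    (hl : ∀ i, len (Pi.single i 1) = l (f i))
    (hC : ∀ i j, t i * B (Pi.single i 1) (Pi.single j 1) = t j * eval (C (e j)) (e i))
    {Λ : Set (ι → ℝ)} (hN : Λ ⊆ N) (h0 : ∀ x ∈ Λ, 0 ≤ x) (ha : IsLengthAntichain len Λ) :
    LinearIndepOn ℝ id Λ := by
  -- Here `t k` converts a table coordinate to the normalized simple root `k`, and `s` rescales a
  -- root according to its mark. Coordinates outside the range of `e` vanish, so a table can also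
  -- serve a subdiagram.
  have key : ∀ x ∈ N, 0 ≤ x → ∃ c ∈ L, (∀ k, x k = s c.1 * t k * eval c.2 (e k)) ∧
      (∀ k, k ∉ Set.range e → coord c.2 k = (0, 0)) ∧ len x = l c.1 := by
    refine h.positive_induction _ (fun i => ⟨_, hsimple i, fun k => ?_, fun k hk => ?_, hl i⟩)
      fun i x hx _ hne hP => ?_
    · simp only [eval, coord_single, he.eq_iff]
      by_cases hki : k = i
      · subst hki; simp [hst, GoldenInt.val_one]
      · simp [hki, GoldenInt.val_zero]
    · rw [coord_single, if_neg]
      rintro rfl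
      exact hk ⟨i, rfl⟩
    · obtain ⟨c, hc, hxc, hout, hlen⟩ := hP
      have hcs : c.2 ≠ GoldenVec.single (e i) := by
        intro hci
        refine hne (h.eq_of_smul hx (h.single_mem i) (c := s c.1 * t i)
          (mul_nonneg (hs _).le (ht i).le) ?_)
        funext k
        rw [hxc k, hci]
        simp only [eval, coord_single, he.eq_iff]
        by_cases hki : k = i
        · subst hki; simp [GoldenInt.val_one]
        · simp [hki, GoldenInt.val_zero]
      have hmem : (c.1, reflect C (e i) c.2) ∈ L := by
        simp only [closedUnderReflections, List.all_eq_true] at hL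
        have h1 := hL c hc (e i) (by
          generalize e i = a
          fin_cases a <;> simp)
        simpa [hcs] using h1
      refine ⟨_, hmem, fun k => ?_, fun k hk => ?_, ?_⟩
      · have hsum : ∑ k, eval (C (e i)) k * eval c.2 k =
            ∑ k, eval (C (e i)) (e k) * eval c.2 (e k) := by
          refine (Finset.sum_subset (Finset.subset_univ (Finset.univ.image e)) fun k _ hk => ?_).symm
            |>.trans (Finset.sum_image he.injOn)
          have h1 := hout k fun ⟨i, hi⟩ => hk (hi ▸ Finset.mem_image_of_mem e (Finset.mem_univ i))
          simp [eval, h1, GoldenInt.val_zero]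
        simp only [eval_reflect, he.eq_iff]
        have hBx : B x (Pi.single i 1) =
            s c.1 * t i * ∑ k, eval (C (e i)) k * eval c.2 k := by
          rw [hsum, h.symm, bilin_eq_sum, Finset.mul_sum]
          refine Finset.sum_congr rfl fun k _ => ?_
          rw [hxc k, h.symm (Pi.single i 1)]
          linear_combination (s c.1 * eval c.2 (e k)) * hC k i
        rw [hBx]
        by_cases hki : k = i
        · subst hki
          simp only [Pi.sub_apply, Pi.smul_apply, Pi.single_eq_same, smul_eq_mul, if_true, hxc k]
          ring
        · simp [hki, hxc k]
      · rw [coord_reflect_of_ne _ _]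
        · exact hout k hk
        · rintro rfl
          exact hk ⟨i, rfl⟩
      · rw [h.len_refl i x hx, hlen]
  choose! code hcode hx hout hlen using key
  let dec : Bool × GoldenVec → ι → ℝ := fun c k => s c.1 * t k * eval c.2 (e k)
  have hdec : ∀ x ∈ Λ, dec (code x) = x := fun x hxΛ =>
    funext fun k => (hx x (hN hxΛ) (h0 x hxΛ) k).symm
  rw [linearIndepOn_iff']
  intro T g hT hsum
  have hinj : Set.InjOn code T := fun x hx' y hy' hxy => by
    rw [← hdec x (hT hx'), ← hdec y (hT hy'), hxy]
  have hle : ∀ x ∈ T, ∀ y ∈ T, code x ≠ code y → GoldenVec.le (code x) (code y) = false := by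
    intro x hxT y hyT hne
    by_contra hle
    obtain ⟨h1, h2⟩ := eval_le_of_le (Bool.not_eq_false _ ▸ hle)
    refine ha x (hT hxT) y (hT hyT) (fun hxy => hne (by rw [hxy])) ?_ fun k => ?_
    · rw [hlen x (hN (hT hxT)) (h0 x (hT hxT)), hlen y (hN (hT hyT)) (h0 y (hT hyT)), h1]
    · rw [hx x (hN (hT hxT)) (h0 x (hT hxT)), hx y (hN (hT hyT)) (h0 y (hT hyT)), h1]
      exact mul_le_mul_of_nonneg_left (h2 (e k)) (mul_nonneg (hs _).le (ht k).le)
  have hzero := antichainsIndependent_sound n L [] ⊥ isEchelon_nil hn (T.image code)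
    (fun c hc => by
      obtain ⟨x, hxT, rfl⟩ := Finset.mem_image.1 hc
      exact hcode x (hN (hT hxT)) (h0 x (hT hxT)))
    (fun c hc d hd hcd => by
      obtain ⟨x, hxT, rfl⟩ := Finset.mem_image.1 hc
      obtain ⟨y, hyT, rfl⟩ := Finset.mem_image.1 hd
      simp [incomparable, hle x hxT y hyT hcd, hle y hyT x hxT hcd.symm])
    -- The factor `s` is absorbed into the coefficients, and `t i` cancels in each coordinate of the
    -- relation.
    (fun c => g (dec c) * s c.1)
    (by
      rw [Submodule.mem_bot, Finset.sum_image hinj]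
      funext k
      rw [Finset.sum_apply]
      by_cases hk : k ∈ Set.range e
      · obtain ⟨i, rfl⟩ := hk
        have h1 := congrFun hsum i
        simp only [Finset.sum_apply, Pi.smul_apply, id, smul_eq_mul, Pi.zero_apply] at h1 ⊢
        refine (mul_eq_zero.1 (?_ : t i * _ = 0)).resolve_left (ht i).ne'
        rw [Finset.mul_sum, ← h1]
        refine Finset.sum_congr rfl fun x hxT => ?_
        rw [hdec x (hT hxT)]
        have h2 := hx x (hN (hT hxT)) (h0 x (hT hxT)) i
        linear_combination (-g x) * h2
      · refine Finset.sum_eq_zero fun x hxT => ?_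
        have h2 := hout x (hN (hT hxT)) (h0 x (hT hxT)) k hk
        simp [eval, h2, GoldenInt.val_zero])
  intro x hxT
  have h1 := hzero (code x) (Finset.mem_image_of_mem _ hxT)
  rw [hdec x (hT hxT)] at h1
  exact (mul_eq_zero.1 h1).resolve_right (hs _).ne'

/-! ### Diagrams of type B -/

/-- For simple roots forming a diagram of type `B` with short end `u 0`, these vectors form an
orthonormal basis, up to scaling. -/
noncomputable def chainVec {ι : Type*} [DecidableEq ι] (u : ℕ → ι) : ℕ → ι → ℝ
  | 0 => (√2)⁻¹ • Pi.single (u 0) 1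
  | j + 1 => Pi.single (u (j + 1)) 1 + chainVec u j

/-- The simple roots `u 0, …, u (k - 1)` form a diagram of type `B` with short end `u 0 = p`. -/
structure IsTypeBChain {ι : Type*} [DecidableEq ι] (B : LinearMap.BilinForm ℝ (ι → ℝ)) (p : ι)
    (u : ℕ → ι) (k : ℕ) : Prop where
  zero : u 0 = p
  inj : ∀ i < k, ∀ j < k, u i = u j → i = j
  orth : ∀ i < k, ∀ j < k, B (chainVec u i) (chainVec u j) = if i = j then 1 else 0

section chainVec

variable {ι : Type*} [DecidableEq ι]

theorem chainVec_congr {u v : ℕ → ι} {j : ℕ} (h : ∀ i ≤ j, u i = v i) :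
    chainVec u j = chainVec v j := by
  induction j with
  | zero => simp [chainVec, h 0 le_rfl]
  | succ j ih => rw [chainVec, chainVec, h _ le_rfl, ih fun i hi => h i (by omega)]

theorem chainVec_apply_eq_zero {u : ℕ → ι} {j : ℕ} {z : ι} (h : ∀ i ≤ j, u i ≠ z) :
    chainVec u j z = 0 := by
  induction j with
  | zero => simp [chainVec, (h 0 le_rfl).symm]
  | succ j ih =>
    simp [chainVec, (h (j + 1) le_rfl).symm, ih fun i hi => h i (by omega)]

theorem single_eq_chainVec_zero (u : ℕ → ι) :
    (Pi.single (u 0) 1 : ι → ℝ) = √2 • chainVec u 0 := by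
  rw [chainVec, smul_smul, mul_inv_cancel₀ (by positivity), one_smul]

theorem single_eq_chainVec_succ (u : ℕ → ι) (j : ℕ) :
    (Pi.single (u (j + 1)) 1 : ι → ℝ) = chainVec u (j + 1) - chainVec u j := by
  rw [chainVec, add_sub_cancel_right]

theorem chainVec_mono (u : ℕ → ι) : Monotone (chainVec u) :=
  monotone_nat_of_le_succ fun j => by
    rw [← sub_nonneg, ← single_eq_chainVec_succ]
    exact Pi.single_nonneg.2 zero_le_one

theorem chainVec_nonneg (u : ℕ → ι) (j : ℕ) : 0 ≤ chainVec u j := by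
  refine le_trans ?_ (chainVec_mono u (Nat.zero_le j))
  rw [chainVec]
  exact smul_nonneg (by positivity) (Pi.single_nonneg.2 zero_le_one)

end chainVec

namespace NormalizedSystem

set_option linter.unusedSectionVars false

variable {ι : Type*} [Fintype ι] [DecidableEq ι] {B : LinearMap.BilinForm ℝ (ι → ℝ)}
  {N : Set (ι → ℝ)} {len : (ι → ℝ) → ℝ}

/-- Connectedness supplies a neighbour `z` of the chain. Bessel's inequality for `z` against the
orthonormal vectors of the chain leaves only one possibility: `z` is attached to the last root, in
the way that continues type B. -/
theorem exists_isTypeBChain_succ (h : NormalizedSystem B N len) (hc : IsConnectedForm B)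
    (hb : ∀ i j, i ≠ j → B (Pi.single i 1) (Pi.single j 1) = 0 ∨
      B (Pi.single i 1) (Pi.single j 1) = -1 ∨ B (Pi.single i 1) (Pi.single j 1) ≤ -√2)
    {p q : ι} (hpq : B (Pi.single p 1) (Pi.single q 1) = -√2)
    (hleaf : ∀ i, i ≠ p → i ≠ q → B (Pi.single p 1) (Pi.single i 1) = 0)
    {u : ℕ → ι} {k : ℕ} (hu : IsTypeBChain B p u (k + 1)) (hz : ∃ z, ∀ j < k + 1, u j ≠ z) :
    ∃ v, IsTypeBChain B p v (k + 2) := by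
  have h2 : 0 < √2 := by positivity
  have h22 : √2 * √2 = 2 := Real.mul_self_sqrt (by norm_num)
  have h21 : 1 ≤ √2 := Real.one_le_sqrt.2 (by norm_num)
  obtain ⟨z, a, ha, hza, hz⟩ : ∃ z a, a < k + 1 ∧
      B (Pi.single (u a) 1) (Pi.single z 1) ≠ 0 ∧ ∀ j < k + 1, u j ≠ z := by
    by_contra! hcon
    obtain ⟨z, hz⟩ := hz
    obtain ⟨j, hj, hjz⟩ := hc {i | ∃ j < k + 1, u j = i} ⟨u 0, 0, by omega, rfl⟩ (by
      rintro _ ⟨j, hj, rfl⟩ z hzne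
      by_contra hcon'
      simp only [Set.mem_ofPred_eq, not_exists, not_and] at hcon'
      obtain ⟨l, hl, hlz⟩ := hcon z j hj hzne
      exact hcon' l hl hlz) z
    exact hz j hj hjz
  -- These are the negated Fourier coefficients of simple root `z`. They increase with `j`, by the
  -- negated bonds of `z`.
  set b : ℕ → ℝ := fun j => -B (Pi.single z 1) (chainVec u j) with hbdef
  have hbond : ∀ j < k + 1, B (Pi.single z 1) (Pi.single (u j) 1) ≤ 0 := fun j hj =>
    h.single_nonpos (hz j hj).symm
  have hbond1 : ∀ j < k + 1, B (Pi.single z 1) (Pi.single (u j) 1) ≠ 0 →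
      B (Pi.single z 1) (Pi.single (u j) 1) ≤ -1 := by
    intro j hj hne
    rcases hb z (u j) (hz j hj).symm with h1 | h1 | h1
    · exact absurd h1 hne
    · exact h1.le
    · linarith
  have hbs : ∀ j, b (j + 1) = b j - B (Pi.single z 1) (Pi.single (u (j + 1)) 1) := by
    intro j
    simp only [hbdef, chainVec, map_add]
    ring
  have hb0 : b 0 = -((√2)⁻¹ * B (Pi.single z 1) (Pi.single p 1)) := by
    simp only [hbdef, chainVec, map_smul, smul_eq_mul, hu.zero]
  have hmono : ∀ j < k + 1, ∀ i ≤ j, b i ≤ b j := by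
    intro j hj
    induction j with
    | zero => intro i hi; rw [Nat.le_zero.1 hi]
    | succ j ih =>
      intro i hi
      rcases Nat.lt_or_eq_of_le hi with hi | rfl
      · have := ih (by omega) i (by omega)
        rw [hbs]
        linarith [hbond (j + 1) hj]
      · exact le_rfl
  have hb0' : 0 ≤ b 0 := by
    rw [hb0, ← hu.zero]
    have := hbond 0 (by omega)
    have h3 : 0 < (√2)⁻¹ := by positivity
    nlinarith
  have hne : ∀ c d : ℝ, ∀ i < k + 1, ∀ j < k + 1,
      Pi.single z 1 + c • chainVec u i + d • chainVec u j ≠ 0 := by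
    intro c d i hi j hj he
    have := congrFun he z
    simp [chainVec_apply_eq_zero (fun l (hl : l ≤ i) => hz l (by omega)),
      chainVec_apply_eq_zero (fun l (hl : l ≤ j) => hz l (by omega))] at this
  have hsymm : ∀ j, B (chainVec u j) (Pi.single z 1) = -b j := by
    intro j
    rw [h.symm]; simp [hbdef]
  have hsymm' : ∀ j, B (Pi.single z 1) (chainVec u j) = -b j := by
    intro j
    simp [hbdef]
  have bessel2 : ∀ i < k + 1, ∀ j < k + 1, i ≠ j → b i ^ 2 + b j ^ 2 < 2 := by
    intro i hi j hj hij
    have h1 := h.pos _ (hne (b i) (b j) i hi j hj)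
    simp only [map_add, map_smul, LinearMap.add_apply, LinearMap.smul_apply, smul_eq_mul, hsymm,
      hsymm', h.single_norm, hu.orth i hi j hj, hu.orth i hi i hi, hu.orth j hj j hj,
      hu.orth j hj i hi, if_neg hij, if_neg hij.symm, if_true] at h1
    nlinarith
  have bessel1 : ∀ i < k + 1, b i ^ 2 < 2 := by
    intro i hi
    have h1 := h.pos _ (hne (b i) 0 i hi i hi)
    simp only [map_add, map_smul, LinearMap.add_apply, LinearMap.smul_apply, smul_eq_mul, hsymm,
      hsymm', h.single_norm, hu.orth i hi i hi, if_true] at h1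
    nlinarith
  have hbk : b k = 1 ∧ ∀ j < k, b j = 0 := by
    rcases Nat.eq_zero_or_pos k with rfl | hk
    · refine ⟨?_, by omega⟩
      obtain rfl : a = 0 := by omega
      have hzq : z = q := by
        by_contra hzq
        rw [hu.zero] at hza
        exact hza (hleaf z (fun hzp => hz 0 (by omega) (hu.zero.trans hzp.symm)) hzq)
      rw [hb0, hzq, h.symm, hpq]
      field_simp
    · have hu1 : u 1 = q := by
        by_contra hu1
        have h3 := hleaf (u 1) (fun he => by
          have := hu.inj 1 (by omega) 0 (by omega) (he.trans hu.zero.symm)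
          omega) hu1
        rw [single_eq_chainVec_succ u 0, ← hu.zero, single_eq_chainVec_zero] at h3
        simp [hu.orth 0 (by omega) 1 (by omega), hu.orth 0 (by omega) 0 (by omega)] at h3
      have hb00 : b 0 = 0 := by
        rw [hb0, h.symm, hleaf z (fun hzp => hz 0 (by omega) (hu.zero.trans hzp.symm))
          (fun hzq => hz 1 (by omega) (hu1.trans hzq.symm))]
        simp
      have hj0 : ∀ j < k, b j = 0 := by
        intro j
        induction j with
        | zero => intro _; exact hb00
        | succ j ih =>
          intro hj
          have hbj := ih (by omega)
          by_contra hbne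
          have h3 := hbond1 (j + 1) (by omega) (fun he => hbne (by rw [hbs, hbj, he, sub_zero]))
          have h4 : 1 ≤ b (j + 1) := by rw [hbs, hbj]; linarith
          have h5 := hmono k (by omega) (j + 1) (by omega)
          -- A bond before the end of the chain would give two coefficients that are at least 1,
          -- against a sum of squares below 2.
          have h6 := bessel2 (j + 1) (by omega) k (by omega) (by omega)
          nlinarith
      refine ⟨?_, hj0⟩
      obtain ⟨l, rfl⟩ : ∃ l, k = l + 1 := ⟨k - 1, by omega⟩
      have hal : a = l + 1 := by
        by_contra hal
        apply hza
        rcases a with _ | a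
        · rw [hu.zero]
          exact hleaf z (fun hzp => hz 0 (by omega) (hu.zero.trans hzp.symm))
            (fun hzq => hz 1 (by omega) (hu1.trans hzq.symm))
        · have h3 := hbs a
          rw [hj0 a (by omega), hj0 (a + 1) (by omega)] at h3
          rw [h.symm]
          linarith
      rw [hal] at hza
      have h3 := bessel1 (l + 1) (by omega)
      have h4 := hbs l
      rw [hj0 l (by omega)] at h4
      rcases hb z (u (l + 1)) (hz _ (by omega)).symm with h5 | h5 | h5
      · exact absurd (by rw [h.symm, h5]) hza
      · rw [h4, h5]; ring
      · rw [h4] at h3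
        nlinarith
  have hcongr : ∀ j < k + 1, chainVec (Function.update u (k + 1) z) j = chainVec u j := by
    intro j hj
    apply chainVec_congr
    intro i hi
    rw [Function.update_of_ne (by omega)]
  have hlast : chainVec (Function.update u (k + 1) z) (k + 1) =
      Pi.single z 1 + chainVec u k := by
    rw [chainVec, Function.update_self, hcongr k (by omega)]
  have horth : ∀ i < k + 1, B (chainVec (Function.update u (k + 1) z) i)
      (chainVec (Function.update u (k + 1) z) (k + 1)) = 0 := by
    intro i hi
    rw [hlast, hcongr i hi, map_add, hsymm, hu.orth i hi k (by omega)]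
    by_cases hik : i = k
    · subst hik; simp [hbk.1]
    · simp [hik, hbk.2 i (by omega)]
  refine ⟨Function.update u (k + 1) z, ?_, fun i hi j hj hij => ?_, fun i hi j hj => ?_⟩
  · rw [Function.update_of_ne (by omega), hu.zero]
  · by_cases hi' : i = k + 1 <;> by_cases hj' : j = k + 1
    · omega
    · rw [hi', Function.update_self, Function.update_of_ne hj'] at hij
      exact absurd hij.symm (hz j (by omega))
    · rw [hj', Function.update_self, Function.update_of_ne hi'] at hij
      exact absurd hij (hz i (by omega))
    · rw [Function.update_of_ne hi', Function.update_of_ne hj'] at hij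
      exact hu.inj i (by omega) j (by omega) hij
  · by_cases hi' : i = k + 1 <;> by_cases hj' : j = k + 1
    · subst hi'; subst hj'
      rw [hlast]
      simp only [map_add, LinearMap.add_apply, hsymm, hsymm', h.single_norm,
        hu.orth k (by omega) k (by omega), hbk.1, if_true]
      norm_num
    · subst hi'
      rw [h.symm, horth j (by omega), if_neg (Ne.symm hj')]
    · subst hj'
      rw [horth i (by omega), if_neg hi']
    · rw [hcongr i (by omega), hcongr j (by omega), hu.orth i (by omega) j (by omega)]

/-- Otherwise the chain could be prolonged indefinitely, although its members are distinct elements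
of a finite set. -/
theorem exists_isTypeBChain (h : NormalizedSystem B N len) (hc : IsConnectedForm B)
    (hb : ∀ i j, i ≠ j → B (Pi.single i 1) (Pi.single j 1) = 0 ∨
      B (Pi.single i 1) (Pi.single j 1) = -1 ∨ B (Pi.single i 1) (Pi.single j 1) ≤ -√2)
    {p q : ι} (hpq : B (Pi.single p 1) (Pi.single q 1) = -√2)
    (hleaf : ∀ i, i ≠ p → i ≠ q → B (Pi.single p 1) (Pi.single i 1) = 0) :
    ∃ u k, IsTypeBChain B p u k ∧ ∀ i, ∃ j < k, u j = i := by
  by_contra! hcon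
  have hall : ∀ k, ∃ u, IsTypeBChain B p u (k + 1) := by
    intro k
    induction k with
    | zero =>
      refine ⟨fun _ => p, rfl, by omega, fun i hi j hj => ?_⟩
      obtain rfl : i = 0 := by omega
      obtain rfl : j = 0 := by omega
      have h22 : √2 * √2 = 2 := Real.mul_self_sqrt (by norm_num)
      have h2 : 0 < √2 := by positivity
      simp only [chainVec, map_smul, LinearMap.smul_apply, smul_eq_mul, h.single_norm, if_true]
      rw [← mul_assoc, ← mul_inv, h22]
      norm_num
    | succ k ih =>
      obtain ⟨u, hu⟩ := ih
      obtain ⟨z, hz⟩ := hcon u (k + 1) hu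
      exact h.exists_isTypeBChain_succ hc hb hpq hleaf hu ⟨z, hz⟩
  obtain ⟨u, hu⟩ := hall (Fintype.card ι)
  have := Fintype.card_le_of_injective (fun i : Fin (Fintype.card ι + 1) => u i) fun i j hij =>
    Fin.ext (hu.inj i i.2 j j.2 hij)
  simp at this

end NormalizedSystem

/-! ### Roots and length antichains in type B -/

namespace NormalizedSystem

set_option linter.unusedSectionVars false

variable {ι : Type*} [Fintype ι] [DecidableEq ι] {B : LinearMap.BilinForm ℝ (ι → ℝ)}
  {N : Set (ι → ℝ)} {len : (ι → ℝ) → ℝ}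

theorem refl_chainVec_zero {p : ι} {u : ℕ → ι} {k : ℕ} (hu : IsTypeBChain B p u k) (hk : 0 < k)
    {a : ℕ} (ha : a < k) :
    chainVec u a - B (chainVec u a) (Pi.single (u 0) 1) • Pi.single (u 0) (1 : ℝ) =
      if a = 0 then -chainVec u a else chainVec u a := by
  have h22 : √2 * √2 = 2 := Real.mul_self_sqrt (by norm_num)
  rw [single_eq_chainVec_zero, map_smul, hu.orth a ha 0 hk]
  split_ifs with h0
  · subst h0
    rw [smul_eq_mul, mul_one, smul_smul, h22, two_smul]
    abel
  · simp

theorem refl_chainVec_succ {p : ι} {u : ℕ → ι} {k : ℕ} (hu : IsTypeBChain B p u k) {m : ℕ}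
    (hm : m + 1 < k) {a : ℕ} (ha : a < k) :
    chainVec u a - B (chainVec u a) (Pi.single (u (m + 1)) 1) • Pi.single (u (m + 1)) (1 : ℝ) =
      chainVec u (Equiv.swap m (m + 1) a) := by
  rw [single_eq_chainVec_succ, map_sub, hu.orth a ha _ hm, hu.orth a ha m (by omega),
    Equiv.swap_apply_def]
  by_cases h1 : a = m
  · subst h1; simp
  · by_cases h2 : a = m + 1
    · subst h2; simp
    · simp [h1, h2]

/-- The simple reflections change the sign of the first orthonormal vector or swap two consecutive
ones, and both operations preserve this list up to sign. -/
theorem typeB_root_cases (h : NormalizedSystem B N len) {p : ι} {u : ℕ → ι} {k : ℕ}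
    (hu : IsTypeBChain B p u k) (hsurj : ∀ i, ∃ j < k, u j = i)
    (hb : ∀ i j, i ≠ j → B (Pi.single i 1) (Pi.single j 1) = -1 →
      len (Pi.single i 1) = len (Pi.single j 1)) :
    ∀ x ∈ N, 0 ≤ x →
      (∃ i < k, x = √2 • chainVec u i ∧ len x = len (Pi.single (u 0) 1)) ∨
      (∃ i j, i < j ∧ j < k ∧ (x = chainVec u j - chainVec u i ∨ x = chainVec u j + chainVec u i) ∧
        len x = len (Pi.single (u 1) 1)) := by
  have hbond : ∀ j, j + 2 < k → B (Pi.single (u (j + 1)) 1) (Pi.single (u (j + 2)) 1) = -1 := by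
    intro j hj
    rw [single_eq_chainVec_succ, single_eq_chainVec_succ]
    simp [hu.orth j (by omega) (j + 1) (by omega), hu.orth (j + 1) (by omega) (j + 1) (by omega),
      hu.orth j (by omega) (j + 2) (by omega), hu.orth (j + 1) (by omega) (j + 2) (by omega)]
  have hlen : ∀ j, j + 1 < k → len (Pi.single (u (j + 1)) 1) = len (Pi.single (u 1) 1) := by
    intro j
    induction j with
    | zero => intro _; rfl
    | succ j ih =>
      intro hj
      rw [← ih (by omega)]
      refine (hb _ _ (fun he => ?_) (hbond j hj)).symm
      have := hu.inj _ (by omega) _ (by omega) he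
      omega
  refine h.positive_induction _ (fun i => ?_) fun i x hx hx0 hne hP => ?_
  · obtain ⟨_ | j, hj, rfl⟩ := hsurj i
    · exact Or.inl ⟨0, hj, single_eq_chainVec_zero u, rfl⟩
    · exact Or.inr ⟨j, j + 1, by omega, hj, Or.inl (single_eq_chainVec_succ u j), hlen j hj⟩
  · have hsx := h.refl_nonneg hx hx0 hne
    have hlx := h.len_refl i x hx
    have hlin : ∀ y z : ι → ℝ, (y + z) - B (y + z) (Pi.single i 1) • Pi.single i (1 : ℝ) =
        (y - B y (Pi.single i 1) • Pi.single i 1) +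
          (z - B z (Pi.single i 1) • Pi.single i 1) := by
      intro y z
      simp only [map_add, LinearMap.add_apply]
      module
    have hlin' : ∀ y z : ι → ℝ, (y - z) - B (y - z) (Pi.single i 1) • Pi.single i (1 : ℝ) =
        (y - B y (Pi.single i 1) • Pi.single i 1) -
          (z - B z (Pi.single i 1) • Pi.single i 1) := by
      intro y z
      simp only [map_sub, LinearMap.sub_apply]
      module
    have hlins : ∀ (c : ℝ) (y : ι → ℝ), (c • y) - B (c • y) (Pi.single i 1) • Pi.single i (1 : ℝ) =
        c • (y - B y (Pi.single i 1) • Pi.single i 1) := by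
      intro c y
      simp only [map_smul, LinearMap.smul_apply, smul_eq_mul]
      module
    obtain ⟨_ | m, hm, rfl⟩ := hsurj i
    · have hr := fun a (ha : a < k) => refl_chainVec_zero hu hm ha
      rcases hP with ⟨a, haa, rfl, hl⟩ | ⟨a, b, hab, hbk, hP, hl⟩
      · left
        refine ⟨a, haa, ?_, hlx.trans hl⟩
        rw [hlins, hr a haa, if_neg]
        rintro rfl
        exact hne (single_eq_chainVec_zero u).symm
      · right
        refine ⟨a, b, hab, hbk, ?_, hlx.trans hl⟩
        rcases hP with rfl | rfl
        · rw [hlin', hr a (by omega), hr b hbk, if_neg (by omega)]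
          split_ifs
          · right; abel
          · left; rfl
        · rw [hlin, hr a (by omega), hr b hbk, if_neg (by omega)]
          split_ifs
          · left; abel
          · right; rfl
    · have hr := fun a (ha : a < k) => refl_chainVec_succ hu hm ha
      have hσ : ∀ a < k, Equiv.swap m (m + 1) a < k := by
        intro a haa
        rw [Equiv.swap_apply_def]
        split_ifs <;> omega
      rcases hP with ⟨a, haa, rfl, hl⟩ | ⟨a, b, hab, hbk, hP, hl⟩
      · left
        refine ⟨_, hσ a haa, ?_, hlx.trans hl⟩
        rw [hlins, hr a haa]
      · right
        -- A swap of neighbours reverses the order of `a` and `b` only if these are the two swapped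
        -- indices. Then `E b - E a` is the reflecting simple root, which is excluded, and `E b + E
        -- a` is fixed.
        have hcase : (a = m ∧ b = m + 1) ∨
            Equiv.swap m (m + 1) a < Equiv.swap m (m + 1) b := by
          rw [Equiv.swap_apply_def, Equiv.swap_apply_def]
          split_ifs <;> omega
        rcases hP with rfl | rfl
        · rcases hcase with ⟨rfl, rfl⟩ | hlt
          · exact absurd (single_eq_chainVec_succ u a).symm hne
          · refine ⟨_, _, hlt, hσ b hbk, Or.inl ?_, hlx.trans hl⟩
            rw [hlin', hr a (by omega), hr b hbk]
        · rcases hcase with ⟨rfl, rfl⟩ | hlt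
          · refine ⟨a, a + 1, hab, hbk, Or.inr ?_, hlx.trans hl⟩
            rw [hlin, hr a (by omega), hr _ hbk]
            simp [add_comm]
          · refine ⟨_, _, hlt, hσ b hbk, Or.inr ?_, hlx.trans hl⟩
            rw [hlin, hr a (by omega), hr b hbk]

/-- As `E` is increasing and nonnegative, the roots `√2 • E i` form a chain, and so do the roots `E
j ± E i` with fixed `j`. So `Λ` has at most one root of the first kind and at most one of the second
for each `j`. A functional vanishing on the latter, but on no `E i`, removes the root of the first
kind; the others are triangular in the leading index. -/
theorem linearIndepOn_of_typeB (h : NormalizedSystem B N len) {p : ι} {u : ℕ → ι} {k : ℕ}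
    (hu : IsTypeBChain B p u k) (hsurj : ∀ i, ∃ j < k, u j = i)
    (hb : ∀ i j, i ≠ j → B (Pi.single i 1) (Pi.single j 1) = -1 →
      len (Pi.single i 1) = len (Pi.single j 1))
    {Λ : Set (ι → ℝ)} (hN : Λ ⊆ N) (h0 : ∀ x ∈ Λ, 0 ≤ x) (ha : IsLengthAntichain len Λ) :
    LinearIndepOn ℝ id Λ := by
  have h2 : 0 < √2 := by positivity
  set E := chainVec u with hE
  have hEmono : Monotone E := chainVec_mono u
  have hE0 : ∀ j, 0 ≤ E j := chainVec_nonneg u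
  have hroots : ∀ x ∈ Λ, (∃ i < k, x = √2 • E i ∧ len x = len (Pi.single (u 0) 1)) ∨
      (∃ i j, ∃ ε : ℝ, i < j ∧ j < k ∧ (ε = 1 ∨ ε = -1) ∧ x = E j + ε • E i ∧
        len x = len (Pi.single (u 1) 1)) := by
    intro x hx
    rcases h.typeB_root_cases hu hsurj hb x (hN hx) (h0 x hx) with h1 | h1
    · exact Or.inl h1
    · obtain ⟨i, j, hij, hj, hx | hx, hl⟩ := h1
      · exact Or.inr ⟨i, j, -1, hij, hj, Or.inr rfl, by rw [hx]; module, hl⟩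
      · exact Or.inr ⟨i, j, 1, hij, hj, Or.inl rfl, by rw [hx]; module, hl⟩
  have hshort : ∀ i j, √2 • E i ∈ Λ → √2 • E j ∈ Λ →
      len (√2 • E i) = len (√2 • E j) → √2 • E i = √2 • E j := by
    intro i j hi hj hl
    by_contra hne
    rcases le_total i j with hij | hij
    · exact ha _ hi _ hj hne hl (smul_le_smul_of_nonneg_left (hEmono hij) h2.le)
    · exact ha _ hj _ hi (Ne.symm hne) hl.symm (smul_le_smul_of_nonneg_left (hEmono hij) h2.le)
  have hlong : ∀ j i i' (ε ε' : ℝ), (ε = 1 ∨ ε = -1) → (ε' = 1 ∨ ε' = -1) →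
      E j + ε • E i ∈ Λ → E j + ε' • E i' ∈ Λ →
      len (E j + ε • E i) = len (E j + ε' • E i') → E j + ε • E i = E j + ε' • E i' := by
    intro j i i' ε ε' hε hε' hi hi' hl
    by_contra hne
    have key : ε • E i ≤ ε' • E i' ∨ ε' • E i' ≤ ε • E i := by
      rcases hε with rfl | rfl <;> rcases hε' with rfl | rfl <;> simp only [one_smul, neg_smul]
      · rcases le_total i i' with hii | hii
        · exact Or.inl (hEmono hii)
        · exact Or.inr (hEmono hii)
      · exact Or.inr ((neg_nonpos.2 (hE0 _)).trans (hE0 _))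
      · exact Or.inl ((neg_nonpos.2 (hE0 _)).trans (hE0 _))
      · rcases le_total i i' with hii | hii
        · exact Or.inr (neg_le_neg (hEmono hii))
        · exact Or.inl (neg_le_neg (hEmono hii))
    rcases key with hle | hle
    · exact ha _ hi _ hi' hne hl (add_le_add_right hle _)
    · exact ha _ hi' _ hi (Ne.symm hne) hl.symm (add_le_add_right hle _)
  let IsLong : (ι → ℝ) → ℕ → Prop := fun x j => ∃ i, ∃ ε : ℝ, i < j ∧ j < k ∧ (ε = 1 ∨ ε = -1) ∧
    x = E j + ε • E i ∧ len x = len (Pi.single (u 1) 1)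
  have hunique : ∀ j, ∀ x ∈ Λ, ∀ y ∈ Λ, IsLong x j → IsLong y j → x = y := by
    rintro j _ hx _ hy ⟨i, ε, -, -, hε, rfl, hl⟩ ⟨i', ε', -, -, hε', rfl, hl'⟩
    exact hlong j i i' ε ε' hε hε' hx hy (hl.trans hl'.symm)
  -- The values `f j` of the functional on `E j` are chosen by recursion. The only possible root `E
  -- j + ε • E i` in `Λ` prescribes `f j = -(ε * f i)`, which is nonzero since `f i` is.
  have hfun : ∀ n, ∃ f : ℕ → ℝ, (∀ j, f j ≠ 0) ∧ ∀ x ∈ Λ, ∀ i j, ∀ ε : ℝ, j < n → i < j → j < k →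
      (ε = 1 ∨ ε = -1) → x = E j + ε • E i → len x = len (Pi.single (u 1) 1) →
      f j + ε * f i = 0 := by
    intro n
    induction n with
    | zero => exact ⟨fun _ => 1, fun _ => one_ne_zero, fun _ _ _ _ _ hj => by omega⟩
    | succ n ih =>
      obtain ⟨f, hf0, hf⟩ := ih
      by_cases hex : ∃ x ∈ Λ, IsLong x n
      · obtain ⟨x, hx, hxl⟩ := hex
        obtain ⟨i, ε, hi, hnk, hε, hxe, hl⟩ := id hxl
        have hε0 : ε ≠ 0 := by rcases hε with rfl | rfl <;> norm_num
        refine ⟨Function.update f n (-(ε * f i)), fun j => ?_, fun y hy i' j ε' hj hi' hjk hε' hye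
          hl' => ?_⟩
        · by_cases hj : j = n
          · subst hj
            rw [Function.update_self]
            exact neg_ne_zero.2 (mul_ne_zero hε0 (hf0 i))
          · rw [Function.update_of_ne hj]; exact hf0 j
        · by_cases hjn : j = n
          · subst hjn
            rw [Function.update_self, Function.update_of_ne (by omega)]
            have hyx := hunique j y hy x hx ⟨i', ε', hi', hjk, hε', hye, hl'⟩ hxl
            rw [hye, hxe] at hyx
            have h4 := congrArg (fun v => B v (E i')) (add_left_cancel hyx)
            simp only [map_smul, LinearMap.smul_apply, smul_eq_mul, hE,
              hu.orth i' (by omega) i' (by omega), hu.orth i (by omega) i' (by omega)] at h4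
            by_cases hii : i = i'
            · subst hii
              simp only [if_true, mul_one] at h4
              rw [h4]; ring
            · simp only [if_true, mul_one, if_neg hii, mul_zero] at h4
              rcases hε' with h5 | h5 <;> rw [h5] at h4 <;> norm_num at h4
          · rw [Function.update_of_ne hjn, Function.update_of_ne (by omega)]
            exact hf y hy i' j ε' (by omega) hi' hjk hε' hye hl'
      · refine ⟨f, hf0, fun y hy i' j ε' hj hi' hjk hε' hye hl' => ?_⟩
        by_cases hjn : j = n
        · subst hjn
          exact absurd ⟨y, hy, i', ε', hi', hjk, hε', hye, hl'⟩ hex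
        · exact hf y hy i' j ε' (by omega) hi' hjk hε' hye hl'
  obtain ⟨f, hf0, hf⟩ := hfun k
  let F : (ι → ℝ) →ₗ[ℝ] ℝ := ∑ a ∈ range k, f a • (LinearMap.flip B (E a))
  have hFE : ∀ j < k, F (E j) = f j := by
    intro j hj
    simp only [F, LinearMap.sum_apply, LinearMap.smul_apply, LinearMap.flip_apply, smul_eq_mul]
    rw [Finset.sum_eq_single j]
    · rw [hE, hu.orth j hj j hj, if_pos rfl, mul_one]
    · intro a haa haj
      rw [hE, hu.orth j hj a (Finset.mem_range.1 haa), if_neg haj.symm, mul_zero]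
    · intro hj'
      exact absurd (Finset.mem_range.2 hj) hj'
  rw [linearIndepOn_iff']
  intro T g hT hsum
  have hFlong : ∀ x ∈ T, ∀ j, IsLong x j → F x = 0 := by
    rintro x hx j ⟨i, ε, hi, hj, hε, hxe, hl⟩
    rw [hxe, map_add, map_smul, hFE j hj, hFE i (by omega), smul_eq_mul]
    exact hf x (hT hx) i j ε hj hi hj hε hxe hl
  have hgshort : ∀ x ∈ T, ∀ i < k, x = √2 • E i → len x = len (Pi.single (u 0) 1) → g x = 0 := by
    intro x hx i hi hxe hl
    have h1 := congrArg F hsum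
    rw [map_sum, map_zero, Finset.sum_eq_single x] at h1
    · rw [id, map_smul, hxe, map_smul, hFE i hi, smul_eq_mul, smul_eq_mul, ← hxe] at h1
      exact (mul_eq_zero.1 h1).resolve_right (mul_ne_zero h2.ne' (hf0 i))
    · intro y hy hyx
      rw [id, map_smul]
      rcases hroots y (hT hy) with ⟨j, hj, hye, hl'⟩ | ⟨i', j, ε, h1⟩
      · refine absurd ?_ hyx
        rw [hye, hxe]
        exact hshort j i (hye ▸ hT hy) (hxe ▸ hT hx) (by rw [← hye, ← hxe, hl, hl'])
      · rw [hFlong y hy j ⟨i', ε, h1⟩, smul_zero]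
    · intro hx'
      exact absurd hx hx'
  by_contra! hcon
  obtain ⟨x₀, hx₀, hgx₀⟩ := hcon
  have hglong : ∀ x ∈ T, g x ≠ 0 → ∃ j, j < k ∧ IsLong x j := by
    intro x hx hg
    rcases hroots x (hT hx) with ⟨i, hi, hxe, hl⟩ | ⟨i, j, ε, h1⟩
    · exact absurd (hgshort x hx i hi hxe hl) hg
    · exact ⟨j, h1.2.1, i, ε, h1⟩
  choose! lead hlead hleadL using hglong
  -- Pairing the relation with `E` at the largest leading index isolates a single coefficient.
  obtain ⟨x, hx, hmax⟩ := Finset.exists_max_image (T.filter fun x => g x ≠ 0) lead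
    ⟨x₀, Finset.mem_filter.2 ⟨hx₀, hgx₀⟩⟩
  rw [Finset.mem_filter] at hx
  have hBE : ∀ y ∈ T, g y ≠ 0 → B y (E (lead x)) = if lead y = lead x then 1 else 0 := by
    intro y hy hgy
    obtain ⟨i, ε, hi, hj, hε, hye, hl⟩ := hleadL y hy hgy
    have h3 := hmax y (Finset.mem_filter.2 ⟨hy, hgy⟩)
    have hlx := hlead x hx.1 hx.2
    nth_rewrite 1 [hye]
    rw [map_add, map_smul, LinearMap.add_apply, LinearMap.smul_apply, hE,
      hu.orth _ hj _ hlx, hu.orth i (by omega) _ hlx, if_neg (c := i = lead x) (by omega)]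
    simp
  have h1 := congrArg (fun v => B v (E (lead x))) hsum
  simp only [map_sum, LinearMap.sum_apply, map_smul, LinearMap.smul_apply, id, smul_eq_mul,
    map_zero, LinearMap.zero_apply] at h1
  rw [Finset.sum_eq_single x] at h1
  · rw [hBE x hx.1 hx.2, if_pos rfl, mul_one] at h1
    exact hx.2 h1
  · intro y hy hyx
    by_cases hgy : g y = 0
    · rw [hgy, zero_mul]
    · rw [hBE y hy hgy, if_neg, mul_zero]
      intro hl
      refine hyx (hunique (lead x) y (hT hy) x (hT hx.1) ?_ (hleadL x hx.1 hx.2))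
      rw [← hl]
      exact hleadL y hy hgy
  · intro hx'
    exact absurd hx.1 hx'

end NormalizedSystem

/-! ### Excluding diagrams; types H and F -/

open Real

namespace NormalizedSystem

set_option linter.unusedSectionVars false

variable {ι : Type*} [Fintype ι] [DecidableEq ι] {B : LinearMap.BilinForm ℝ (ι → ℝ)}
  {N : Set (ι → ℝ)} {len : (ι → ℝ) → ℝ}

/-- Positivity of the form at an explicit vector, expanded; the coefficient 1 at a root distinct
from the others ensures that the vector is nonzero. This and its analogues are the tests that
exclude diagrams. -/
theorem quadratic_pos_three (h : NormalizedSystem B N len) {i j k : ι} (hik : i ≠ k) (hjk : j ≠ k)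
    (a b : ℝ) :
    0 < 2 * a ^ 2 + 2 * b ^ 2 + 2 + 2 * (a * b) * B (Pi.single i 1) (Pi.single j 1) +
      2 * a * B (Pi.single i 1) (Pi.single k 1) + 2 * b * B (Pi.single j 1) (Pi.single k 1) := by
  have h1 := h.pos (a • Pi.single i 1 + b • Pi.single j 1 + Pi.single k 1) (fun he => by
    have := congrFun he k
    simp [hik.symm, hjk.symm] at this)
  simp only [map_add, map_smul, LinearMap.add_apply, LinearMap.smul_apply, smul_eq_mul,
    h.single_norm, h.symm (Pi.single k 1) (Pi.single i 1), h.symm (Pi.single k 1) (Pi.single j 1),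
    h.symm (Pi.single j 1) (Pi.single i 1)] at h1
  linarith

theorem quadratic_pos_four (h : NormalizedSystem B N len) {i j k l : ι} (hil : i ≠ l)
    (hjl : j ≠ l) (hkl : k ≠ l) (a b c : ℝ) :
    0 < 2 * a ^ 2 + 2 * b ^ 2 + 2 * c ^ 2 + 2 +
      2 * (a * b) * B (Pi.single i 1) (Pi.single j 1) +
      2 * (a * c) * B (Pi.single i 1) (Pi.single k 1) +
      2 * (b * c) * B (Pi.single j 1) (Pi.single k 1) +
      2 * a * B (Pi.single i 1) (Pi.single l 1) + 2 * b * B (Pi.single j 1) (Pi.single l 1) +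
      2 * c * B (Pi.single k 1) (Pi.single l 1) := by
  have h1 := h.pos (a • Pi.single i 1 + b • Pi.single j 1 + c • Pi.single k 1 + Pi.single l 1)
    (fun he => by
      have := congrFun he l
      simp [hil.symm, hjl.symm, hkl.symm] at this)
  simp only [map_add, map_smul, LinearMap.add_apply, LinearMap.smul_apply, smul_eq_mul,
    h.single_norm, h.symm (Pi.single k 1) (Pi.single i 1), h.symm (Pi.single k 1) (Pi.single j 1),
    h.symm (Pi.single j 1) (Pi.single i 1), h.symm (Pi.single l 1) (Pi.single i 1),
    h.symm (Pi.single l 1) (Pi.single j 1), h.symm (Pi.single l 1) (Pi.single k 1)] at h1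
  linarith

theorem quadratic_pos_five (h : NormalizedSystem B N len) {i j k l m : ι} (him : i ≠ m)
    (hjm : j ≠ m) (hkm : k ≠ m) (hlm : l ≠ m) (a b c d : ℝ) :
    0 < 2 * a ^ 2 + 2 * b ^ 2 + 2 * c ^ 2 + 2 * d ^ 2 + 2 +
      2 * (a * b) * B (Pi.single i 1) (Pi.single j 1) +
      2 * (a * c) * B (Pi.single i 1) (Pi.single k 1) +
      2 * (b * c) * B (Pi.single j 1) (Pi.single k 1) +
      2 * (a * d) * B (Pi.single i 1) (Pi.single l 1) +
      2 * (b * d) * B (Pi.single j 1) (Pi.single l 1) +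
      2 * (c * d) * B (Pi.single k 1) (Pi.single l 1) +
      2 * a * B (Pi.single i 1) (Pi.single m 1) + 2 * b * B (Pi.single j 1) (Pi.single m 1) +
      2 * c * B (Pi.single k 1) (Pi.single m 1) + 2 * d * B (Pi.single l 1) (Pi.single m 1) := by
  have h1 := h.pos (a • Pi.single i 1 + b • Pi.single j 1 + c • Pi.single k 1 + d • Pi.single l 1 +
      Pi.single m 1) (fun he => by
      have := congrFun he m
      simp [him.symm, hjm.symm, hkm.symm, hlm.symm] at this)
  simp only [map_add, map_smul, LinearMap.add_apply, LinearMap.smul_apply, smul_eq_mul,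
    h.single_norm, h.symm (Pi.single k 1) (Pi.single i 1), h.symm (Pi.single k 1) (Pi.single j 1),
    h.symm (Pi.single j 1) (Pi.single i 1), h.symm (Pi.single l 1) (Pi.single i 1),
    h.symm (Pi.single l 1) (Pi.single j 1), h.symm (Pi.single l 1) (Pi.single k 1),
    h.symm (Pi.single m 1) (Pi.single i 1), h.symm (Pi.single m 1) (Pi.single j 1),
    h.symm (Pi.single m 1) (Pi.single k 1), h.symm (Pi.single m 1) (Pi.single l 1)] at h1
  linarith

theorem _root_.IsConnectedForm.exists_adjacent (hc : IsConnectedForm B) {S : Set ι}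
    (hS : S.Nonempty) {z : ι} (hz : z ∉ S) :
    ∃ i ∈ S, ∃ j ∉ S, B (Pi.single i 1) (Pi.single j 1) ≠ 0 := by
  by_contra! hcon
  exact hz (hc S hS (fun i hi j hij => by
    by_contra hj
    exact hij (hcon i hi j hj)) z)

/-- In a connected system of rank at least three, simple roots enclose angles `π - π / m` with
`m ≤ 5`. -/
theorem bond_cases_of_connected (h : NormalizedSystem B N len) (hc : IsConnectedForm B)
    (hι : ∀ i j : ι, ∃ k, k ≠ i ∧ k ≠ j) {i j : ι} (hij : i ≠ j) :
    B (Pi.single i 1) (Pi.single j 1) = 0 ∨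
    (B (Pi.single i 1) (Pi.single j 1) = -1 ∧ len (Pi.single i 1) = len (Pi.single j 1)) ∨
    B (Pi.single i 1) (Pi.single j 1) = -√2 ∨
    (B (Pi.single i 1) (Pi.single j 1) = -goldenRatio ∧
      len (Pi.single i 1) = len (Pi.single j 1)) := by
  have hle : ∀ i j : ι, i ≠ j → B (Pi.single i 1) (Pi.single j 1) ≠ 0 →
      B (Pi.single i 1) (Pi.single j 1) ≤ -1 := by
    intro i j hij hne
    rcases h.bond_cases hij with h1 | h1 | h1 | h1 | h1
    · exact absurd h1 hne
    · exact h1.1.le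
    · rw [h1, neg_le_neg_iff]; exact Real.one_le_sqrt.2 (by norm_num)
    · rw [h1.1, neg_le_neg_iff]; exact Real.one_lt_goldenRatio.le
    · refine h1.trans ?_
      rw [neg_le_neg_iff]; exact Real.one_le_sqrt.2 (by norm_num)
  have h33 : √3 * √3 = 3 := Real.mul_self_sqrt (by norm_num)
  have h3 : 0 < √3 := by positivity
  have key : ∀ i j k : ι, i ≠ j → k ≠ i → k ≠ j → B (Pi.single i 1) (Pi.single j 1) ≤ -√3 →
      B (Pi.single i 1) (Pi.single k 1) = 0 := by
    intro i j k hij hki hkj hB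
    by_contra hne
    have h4 := hle i k hki.symm hne
    -- The null vector of the affine diagram of type G₂.
    have h5 := h.quadratic_pos_three hki.symm hkj.symm 2 √3
    have h6 := h.single_nonpos hkj.symm
    nlinarith
  rcases h.bond_cases hij with h1 | h1 | h1 | h1 | h1
  · exact Or.inl h1
  · exact Or.inr (Or.inl h1)
  · exact Or.inr (Or.inr (Or.inl h1))
  · exact Or.inr (Or.inr (Or.inr h1))
  · exfalso
    obtain ⟨k, hki, hkj⟩ := hι i j
    obtain ⟨a, ha, z, hz, haz⟩ := hc.exists_adjacent (S := {i, j}) ⟨i, by simp⟩ (z := k)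
      (by simp [hki, hkj])
    simp only [Set.mem_insert_iff, Set.mem_singleton_iff, not_or] at ha hz
    rcases ha with rfl | rfl
    · exact haz (key _ j z hij hz.1 hz.2 h1)
    · exact haz (key _ i z hij.symm hz.2 hz.1 (by rw [h.symm]; exact h1))

theorem bond_le_neg_one (h : NormalizedSystem B N len) (hc : IsConnectedForm B)
    (hι : ∀ i j : ι, ∃ k, k ≠ i ∧ k ≠ j) {i j : ι} (hij : i ≠ j)
    (hne : B (Pi.single i 1) (Pi.single j 1) ≠ 0) : B (Pi.single i 1) (Pi.single j 1) ≤ -1 := by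
  rcases h.bond_cases_of_connected hc hι hij with h1 | h1 | h1 | h1
  · exact absurd h1 hne
  · exact h1.1.le
  · rw [h1, neg_le_neg_iff]; exact Real.one_le_sqrt.2 (by norm_num)
  · rw [h1.1, neg_le_neg_iff]; exact Real.one_lt_goldenRatio.le

theorem bond_eq_neg_one (h : NormalizedSystem B N len) (hc : IsConnectedForm B)
    (hι : ∀ i j : ι, ∃ k, k ≠ i ∧ k ≠ j) {i j : ι} (hij : i ≠ j)
    (hne : B (Pi.single i 1) (Pi.single j 1) ≠ 0)
    (hgt : -√2 < B (Pi.single i 1) (Pi.single j 1)) :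
    B (Pi.single i 1) (Pi.single j 1) = -1 ∧ len (Pi.single i 1) = len (Pi.single j 1) := by
  rcases h.bond_cases_of_connected hc hι hij with h1 | h1 | h1 | h1
  · exact absurd h1 hne
  · exact h1
  · rw [h1] at hgt; exact absurd hgt (lt_irrefl _)
  · rw [h1.1] at hgt
    have h2 : √2 < 1.5 := (Real.sqrt_lt' (by norm_num)).2 (by norm_num)
    have h3 := GoldenInt.goldenRatio_bounds.1
    linarith

-- Starting from the bond `-φ`, connectedness adds neighbours one at a time, and positivity of the
-- form forces a path `p, q, s, z` with simple bonds after the first. The result is H₃ or H₄; for H₃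
-- the table of H₄ is used with last coordinate zero.
set_option maxHeartbeats 1000000 in
theorem linearIndepOn_of_typeH (h : NormalizedSystem B N len) (hc : IsConnectedForm B)
    (hι : ∀ i j : ι, ∃ k, k ≠ i ∧ k ≠ j) {p q : ι} (hpq : p ≠ q)
    (hB : B (Pi.single p 1) (Pi.single q 1) = -goldenRatio)
    (hlpq : len (Pi.single p 1) = len (Pi.single q 1))
    (hleaf : ∀ i, i ≠ p → i ≠ q → B (Pi.single p 1) (Pi.single i 1) = 0)
    {Λ : Set (ι → ℝ)} (hN : Λ ⊆ N) (h0 : ∀ x ∈ Λ, 0 ≤ x) (ha : IsLengthAntichain len Λ) :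
    LinearIndepOn ℝ id Λ := by
  obtain ⟨g1, g2⟩ := GoldenInt.goldenRatio_bounds
  have gsq := Real.goldenRatio_sq
  have s1 : (1.41 : ℝ) < √2 := Real.lt_sqrt_of_sq_lt (by norm_num)
  have hle := fun {i j : ι} (hij : i ≠ j) => h.bond_le_neg_one hc hι hij
  have hnp := fun {i j : ι} (hij : i ≠ j) => h.single_nonpos hij
  obtain ⟨s, hsp, hsq, hqs0⟩ : ∃ s, s ≠ p ∧ s ≠ q ∧
      B (Pi.single q 1) (Pi.single s 1) ≠ 0 := by
    obtain ⟨k, hkp, hkq⟩ := hι p q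
    obtain ⟨a, haS, s, hs, has⟩ := hc.exists_adjacent (S := {p, q}) ⟨p, by simp⟩ (z := k)
      (by simp [hkp, hkq])
    simp only [Set.mem_insert_iff, Set.mem_singleton_iff, not_or] at haS hs
    rcases haS with rfl | rfl
    · exact absurd (hleaf s hs.1 hs.2) has
    · exact ⟨s, hs.1, hs.2, has⟩
  have hps := hleaf s hsp hsq
  obtain ⟨hqs, hlqs⟩ := h.bond_eq_neg_one hc hι hsq.symm hqs0 (by
    by_contra! hcon
    have := h.quadratic_pos_three hsp.symm hsq.symm goldenRatio 2
    rw [hB, hps] at this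
    nlinarith)
  have hq : ∀ z, z ≠ p → z ≠ q → z ≠ s → B (Pi.single q 1) (Pi.single z 1) = 0 := by
    intro z hzp hzq hzs
    by_contra hne
    have h1 := hle hzq.symm hne
    have := h.quadratic_pos_four hzp.symm hzq.symm hzs.symm goldenRatio 2 1
    rw [hB, hps, hqs, hleaf z hzp hzq] at this
    have h2 := hnp hzs.symm
    nlinarith
  have hqp : B (Pi.single q 1) (Pi.single p 1) = -goldenRatio := by rw [h.symm, hB]
  have hsp' : B (Pi.single s 1) (Pi.single p 1) = 0 := by rw [h.symm, hps]
  have hsq' : B (Pi.single s 1) (Pi.single q 1) = -1 := by rw [h.symm, hqs]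
  by_cases hex : ∃ z, z ≠ p ∧ z ≠ q ∧ z ≠ s
  swap
  · push Not at hex
    have hall : ∀ k, k = p ∨ k = q ∨ k = s := fun k => by
      by_contra! hcon
      exact hcon.2.2 (hex k hcon.1 hcon.2.1)
    refine h.linearIndepOn_of_table (e := fun k => if k = p then 0 else if k = q then 1 else 2)
      ?_ GoldenVec.typeH_closed GoldenVec.typeH_antichains (t := fun _ => 1) (fun _ => one_pos)
      (s := fun _ => 1) (l := fun _ => len (Pi.single p 1)) (fun _ => one_pos) (f := fun _ => true)
      (fun i => ?_) (fun _ => by norm_num) (fun i => ?_) (fun i j => ?_) hN h0 ha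
    · intro i j hij
      rcases hall i with rfl | rfl | rfl <;> rcases hall j with rfl | rfl | rfl <;>
        first | rfl | (exfalso; revert hij; simp [hpq.symm, hsp, hsq])
    · rcases hall i with rfl | rfl | rfl
      · simp only [if_true]; decide +kernel
      · simp only [hpq.symm, if_true, if_false]; decide +kernel
      · simp only [hsp, hsq, if_false]; decide +kernel
    · rcases hall i with rfl | rfl | rfl
      · rfl
      · exact hlpq.symm
      · exact (hlpq.trans hlqs).symm
    · rcases hall i with rfl | rfl | rfl <;> rcases hall j with rfl | rfl | rfl <;>
        simp [GoldenVec.eval, GoldenVec.typeHCartan, GoldenVec.coord, GoldenInt.val, hpq.symm, hsp,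
          hsq, h.single_norm, hB, hqp, hps, hqs, hsp', hsq']
  obtain ⟨z, hzp, hzq, hzs, hsz0⟩ : ∃ z, z ≠ p ∧ z ≠ q ∧ z ≠ s ∧
      B (Pi.single s 1) (Pi.single z 1) ≠ 0 := by
    obtain ⟨k, hkp, hkq, hks⟩ := hex
    obtain ⟨a, haS, z, hz, haz⟩ := hc.exists_adjacent (S := {p, q, s}) ⟨p, by simp⟩ (z := k)
      (by simp [hkp, hkq, hks])
    simp only [Set.mem_insert_iff, Set.mem_singleton_iff, not_or] at haS hz
    rcases haS with rfl | rfl | rfl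
    · exact absurd (hleaf z hz.1 hz.2.1) haz
    · exact absurd (hq z hz.1 hz.2.1 hz.2.2) haz
    · exact ⟨z, hz.1, hz.2.1, hz.2.2, haz⟩
  have hpz := hleaf z hzp hzq
  have hqz := hq z hzp hzq hzs
  obtain ⟨hsz, hlsz⟩ := h.bond_eq_neg_one hc hι hzs.symm hsz0 (by
    by_contra! hcon
    -- The first three coefficients make this vector orthogonal to `p` and `q`.
    have := h.quadratic_pos_four hzp.symm hzq.symm hzs.symm (2 * goldenRatio) 4
      (6 - 2 * goldenRatio)
    rw [hB, hps, hqs, hpz, hqz] at this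
    nlinarith)
  have hzp' : B (Pi.single z 1) (Pi.single p 1) = 0 := by rw [h.symm, hpz]
  have hzq' : B (Pi.single z 1) (Pi.single q 1) = 0 := by rw [h.symm, hqz]
  have hzs' : B (Pi.single z 1) (Pi.single s 1) = -1 := by rw [h.symm, hsz]
  have hall : ∀ k, k = p ∨ k = q ∨ k = s ∨ k = z := by
    by_contra! hcon
    obtain ⟨k, hkp, hkq, hks, hkz⟩ := hcon
    obtain ⟨a, haS, t, ht, hat⟩ := hc.exists_adjacent (S := {p, q, s, z}) ⟨p, by simp⟩ (z := k)
      (by simp [hkp, hkq, hks, hkz])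
    simp only [Set.mem_insert_iff, Set.mem_singleton_iff, not_or] at haS ht
    obtain ⟨htp, htq, hts, htz⟩ : t ≠ p ∧ t ≠ q ∧ t ≠ s ∧ t ≠ z := ht
    -- The first four coefficients are those of the last root in the table of H₄. Its norm square is
    -- 2, so adding a neighbour `t` of `s` or `z` would make the form negative.
    have h1 := h.quadratic_pos_five htp.symm htq.symm hts.symm htz.symm (3 * goldenRatio + 2)
      (4 * goldenRatio + 2) (3 * goldenRatio + 1) (2 * goldenRatio)
    rw [hB, hps, hqs, hpz, hqz, hsz, hleaf t htp htq, hq t htp htq hts] at h1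
    have h2 := hnp hts.symm
    have h3 := hnp htz.symm
    rcases haS with rfl | rfl | rfl | rfl
    · exact hat (hleaf t htp htq)
    · exact hat (hq t htp htq hts)
    · have h4 := hle hts.symm hat
      nlinarith
    · have h4 := hle htz.symm hat
      nlinarith
  refine h.linearIndepOn_of_table
    (e := fun k => if k = p then 0 else if k = q then 1 else if k = s then 2 else 3)
    ?_ GoldenVec.typeH_closed GoldenVec.typeH_antichains (t := fun _ => 1) (fun _ => one_pos)
    (s := fun _ => 1) (l := fun _ => len (Pi.single p 1)) (fun _ => one_pos) (f := fun _ => true)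
    (fun i => ?_) (fun _ => by norm_num) (fun i => ?_) (fun i j => ?_) hN h0 ha
  · intro i j hij
    rcases hall i with rfl | rfl | rfl | rfl <;> rcases hall j with rfl | rfl | rfl | rfl <;>
      first | rfl | (exfalso; revert hij; simp [hpq.symm, hsp, hsq, hzp, hzq, hzs])
  · rcases hall i with rfl | rfl | rfl | rfl
    · simp only [if_true]; decide +kernel
    · simp only [hpq.symm, if_true, if_false]; decide +kernel
    · simp only [hsp, hsq, if_true, if_false]; decide +kernel
    · simp only [hzp, hzq, hzs, if_false]; decide +kernel
  · rcases hall i with rfl | rfl | rfl | rfl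
    · rfl
    · exact hlpq.symm
    · exact (hlpq.trans hlqs).symm
    · exact (hlpq.trans (hlqs.trans hlsz)).symm
  · rcases hall i with rfl | rfl | rfl | rfl <;> rcases hall j with rfl | rfl | rfl | rfl <;>
      simp [GoldenVec.eval, GoldenVec.typeHCartan, GoldenVec.coord, GoldenInt.val, hpq.symm, hsp,
        hsq, hzp, hzq, hzs, h.single_norm, hB, hqp, hps, hqs, hsp', hsq', hpz, hqz, hsz, hzp',
        hzq', hzs']

-- With neighbours on both sides of the bond `-√2`, the only positive definite possibility is the
-- path `r, p, q, s`. Calling `r` and `p` long is a convention, since after normalization the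
-- diagram is symmetric.
set_option maxHeartbeats 1000000 in
theorem linearIndepOn_of_typeF (h : NormalizedSystem B N len) (hc : IsConnectedForm B)
    (hι : ∀ i j : ι, ∃ k, k ≠ i ∧ k ≠ j) {p q r s : ι} (hpq : p ≠ q)
    (hB : B (Pi.single p 1) (Pi.single q 1) = -√2)
    (hrp : r ≠ p) (hrq : r ≠ q) (hsp : s ≠ p) (hsq : s ≠ q)
    (hpr0 : B (Pi.single p 1) (Pi.single r 1) ≠ 0) (hqs0 : B (Pi.single q 1) (Pi.single s 1) ≠ 0)
    {Λ : Set (ι → ℝ)} (hN : Λ ⊆ N) (h0 : ∀ x ∈ Λ, 0 ≤ x) (ha : IsLengthAntichain len Λ) :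
    LinearIndepOn ℝ id Λ := by
  have s1 : (1.41 : ℝ) < √2 := Real.lt_sqrt_of_sq_lt (by norm_num)
  have s2 : √2 * √2 = 2 := Real.mul_self_sqrt (by norm_num)
  have hle := fun {i j : ι} (hij : i ≠ j) => h.bond_le_neg_one hc hι hij
  have hnp := fun {i j : ι} (hij : i ≠ j) => h.single_nonpos hij
  have hqp : B (Pi.single q 1) (Pi.single p 1) = -√2 := by rw [h.symm, hB]
  have htri : ∀ t, t ≠ p → t ≠ q → B (Pi.single p 1) (Pi.single t 1) ≠ 0 →
      B (Pi.single q 1) (Pi.single t 1) ≠ 0 → False := by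
    intro t htp htq h1 h2
    have h3 := h.quadratic_pos_three htp.symm htq.symm 1 1
    rw [hB] at h3
    have h4 := hle htp.symm h1
    have h5 := hle htq.symm h2
    linarith
  have hrs : r ≠ s := by
    rintro rfl
    exact htri r hrp hrq hpr0 hqs0
  have hqr : B (Pi.single q 1) (Pi.single r 1) = 0 := by
    by_contra hne
    exact htri r hrp hrq hpr0 hne
  have hps : B (Pi.single p 1) (Pi.single s 1) = 0 := by
    by_contra hne
    exact htri s hsp hsq hne hqs0
  obtain ⟨hpr, hlpr⟩ := h.bond_eq_neg_one hc hι hrp.symm hpr0 (by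
    by_contra! hcon
    -- The null vector of a path with two bonds `-√2`.
    have := h.quadratic_pos_three hrp.symm hrq.symm √2 1
    rw [hB, hqr] at this
    nlinarith)
  obtain ⟨hqs, hlqs⟩ := h.bond_eq_neg_one hc hι hsq.symm hqs0 (by
    by_contra! hcon
    have := h.quadratic_pos_three hsp.symm hsq.symm 1 √2
    rw [hB, hps] at this
    nlinarith)
  have hrs' : B (Pi.single r 1) (Pi.single s 1) = 0 := by
    by_contra hne
    have h1 := hle hrs hne
    have := h.quadratic_pos_four hsp.symm hsq.symm hrs 1 1 1
    rw [hB, hpr, hqr, hps, hqs] at this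
    linarith
  have hrp' : B (Pi.single r 1) (Pi.single p 1) = -1 := by rw [h.symm, hpr]
  have hrq' : B (Pi.single r 1) (Pi.single q 1) = 0 := by rw [h.symm, hqr]
  have hsp' : B (Pi.single s 1) (Pi.single p 1) = 0 := by rw [h.symm, hps]
  have hsq' : B (Pi.single s 1) (Pi.single q 1) = -1 := by rw [h.symm, hqs]
  have hsr' : B (Pi.single s 1) (Pi.single r 1) = 0 := by rw [h.symm, hrs']
  have hall : ∀ k, k = r ∨ k = p ∨ k = q ∨ k = s := by
    by_contra! hcon
    obtain ⟨k, hkr, hkp, hkq, hks⟩ := hcon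
    obtain ⟨a, haS, t, ht, hat⟩ := hc.exists_adjacent (S := {r, p, q, s}) ⟨p, by simp⟩ (z := k)
      (by simp [hkr, hkp, hkq, hks])
    simp only [Set.mem_insert_iff, Set.mem_singleton_iff, not_or] at haS ht
    obtain ⟨htr, htp, htq, hts⟩ : t ≠ r ∧ t ≠ p ∧ t ≠ q ∧ t ≠ s := ht
    -- The highest long and the highest short root of F₄ in normalized coordinates. The first
    -- excludes a new neighbour of `r`, `p` or `q`, the second one of `s`.
    have h1 := h.quadratic_pos_five htr.symm htp.symm htq.symm hts.symm 2 3 (2 * √2) √2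
    have h2 := h.quadratic_pos_five htr.symm htp.symm htq.symm hts.symm √2 (2 * √2) 3 2
    rw [hrp', hrq', hB, hrs', hps, hqs] at h1 h2
    have n1 := hnp htr.symm
    have n2 := hnp htp.symm
    have n3 := hnp htq.symm
    have n4 := hnp hts.symm
    rcases haS with rfl | rfl | rfl | rfl
    · have h4 := hle htr.symm hat
      nlinarith
    · have h4 := hle htp.symm hat
      nlinarith
    · have h4 := hle htq.symm hat
      nlinarith
    · have h4 := hle hts.symm hat
      nlinarith
  have hinv2 : (√2)⁻¹ * 2 = √2 := by
    rw [inv_mul_eq_iff_eq_mul₀ (by positivity), s2]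
  refine h.linearIndepOn_of_table
    (e := fun k => if k = r then 0 else if k = p then 1 else if k = q then 2 else 3)
    ?_ GoldenVec.typeF_closed GoldenVec.typeF_antichains
    (t := fun k => if k = r then 1 else if k = p then 1 else (√2)⁻¹) (fun k => ?_)
    (s := fun b => if b then 1 else √2)
    (l := fun b => if b then len (Pi.single p 1) else len (Pi.single q 1)) (fun b => ?_)
    (f := fun k => decide (k = r) || decide (k = p))
    (fun i => ?_) (fun i => ?_) (fun i => ?_) (fun i j => ?_) hN h0 ha
  · intro i j hij
    rcases hall i with rfl | rfl | rfl | rfl <;> rcases hall j with rfl | rfl | rfl | rfl <;>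
      first | rfl | (exfalso; revert hij; simp [hpq.symm, hrp.symm, hrq.symm, hrs.symm, hsp, hsq])
  · rcases hall k with rfl | rfl | rfl | rfl <;>
      simp [hpq.symm, hrp.symm, hrq.symm, hrs.symm, hsp]
  · cases b <;> simp
  · rcases hall i with rfl | rfl | rfl | rfl
    · simp only [if_true, decide_true, Bool.true_or]; decide +kernel
    · simp only [hrp.symm, if_true, if_false, decide_true, Bool.or_true]; decide +kernel
    · simp only [hrq.symm, hpq.symm, if_true, if_false, decide_false, Bool.or_false]
      decide +kernel
    · simp only [hrs.symm, hsp, hsq, if_false, decide_false, Bool.or_false]; decide +kernel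
  · rcases hall i with rfl | rfl | rfl | rfl <;>
      simp [hpq.symm, hrp.symm, hrq.symm, hrs.symm, hsp]
  · rcases hall i with rfl | rfl | rfl | rfl
    · simp [hlpr]
    · simp
    · simp [hrq.symm, hpq.symm]
    · simp [hrs.symm, hsp, hlqs]
  · rcases hall i with rfl | rfl | rfl | rfl <;> rcases hall j with rfl | rfl | rfl | rfl <;>
      simp [GoldenVec.eval, GoldenVec.typeFCartan, GoldenVec.coord, GoldenInt.val, hpq.symm, hsp,
        hsq, hrp.symm, hrq.symm, hrs.symm, h.single_norm, hB, hqp, hps, hqs, hsp', hsq', hpr, hqr,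
        hrp', hrq', hrs', hsr', hinv2]

/-- In a connected system, length antichains of positive roots are linearly independent. -/
theorem linearIndepOn_of_connected (h : NormalizedSystem B N len) (hc : IsConnectedForm B)
    {Λ : Set (ι → ℝ)} (hN : Λ ⊆ N) (h0 : ∀ x ∈ Λ, 0 ≤ x) (ha : IsLengthAntichain len Λ) :
    LinearIndepOn ℝ id Λ := by
  by_cases hι : ∀ i j : ι, ∃ k, k ≠ i ∧ k ≠ j
  swap
  · push Not at hι
    obtain ⟨i, j, hk⟩ := hι
    by_cases hij : i = j
    · subst hij
      have hall : ∀ k, k = i := fun k => by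
        by_contra hne
        exact hne (hk k hne)
      refine h.linearIndepOn_of_simplyLaced hc (fun a b hab => ?_) hN h0 ha
      exact absurd ((hall a).trans (hall b).symm) hab
    · refine h.linearIndepOn_of_rank_two hij (fun k => ?_) hN h0 ha
      by_contra! hcon
      exact hcon.2 (hk k hcon.1)
  obtain ⟨g1, g2⟩ := GoldenInt.goldenRatio_bounds
  have s1 : (1.41 : ℝ) < √2 := Real.lt_sqrt_of_sq_lt (by norm_num)
  have s2 : √2 < 1.42 := (Real.sqrt_lt' (by norm_num)).2 (by norm_num)
  have hle := fun {i j : ι} (hij : i ≠ j) => h.bond_le_neg_one hc hι hij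
  have hnp := fun {i j : ι} (hij : i ≠ j) => h.single_nonpos hij
  have hcases := fun {i j : ι} (hij : i ≠ j) => h.bond_cases_of_connected hc hι hij
  by_cases hH : ∃ p q : ι, p ≠ q ∧ B (Pi.single p 1) (Pi.single q 1) = -goldenRatio ∧
      len (Pi.single p 1) = len (Pi.single q 1)
  · obtain ⟨p, q, hpq, hB, hl⟩ := hH
    by_cases hleaf : ∀ i, i ≠ p → i ≠ q → B (Pi.single p 1) (Pi.single i 1) = 0
    · exact h.linearIndepOn_of_typeH hc hι hpq hB hl hleaf hN h0 ha
    refine h.linearIndepOn_of_typeH hc hι hpq.symm (by rw [h.symm, hB]) hl.symm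
      (fun s hsq hsp => ?_) hN h0 ha
    push Not at hleaf
    obtain ⟨r, hrp, hrq, hpr⟩ := hleaf
    by_contra hqs
    have b1 := hle hrp.symm hpr
    have b2 := hle hsq.symm hqs
    by_cases hrs : r = s
    · subst hrs
      have := h.quadratic_pos_three hrp.symm hrq.symm 1 1
      rw [hB] at this
      linarith
    -- With weight 2 on the ends of the bond `-φ` and 1 on the two outer roots, the form would be at
    -- most `12 - 8 φ < 0`. So one end of the bond is a leaf.
    · have := h.quadratic_pos_four hsp.symm hsq.symm hrs 2 2 1
      rw [hB] at this
      have n1 := hnp hrq.symm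
      have n2 := hnp hsp.symm
      have n3 := hnp hrs
      linarith
  by_cases hF : ∃ p q : ι, p ≠ q ∧ B (Pi.single p 1) (Pi.single q 1) = -√2
  · obtain ⟨p, q, hpq, hB⟩ := hF
    have hB' : ∀ i j, i ≠ j → B (Pi.single i 1) (Pi.single j 1) = 0 ∨
        B (Pi.single i 1) (Pi.single j 1) = -1 ∨ B (Pi.single i 1) (Pi.single j 1) ≤ -√2 := by
      intro i j hij
      rcases hcases hij with h1 | h1 | h1 | h1
      · exact Or.inl h1
      · exact Or.inr (Or.inl h1.1)
      · exact Or.inr (Or.inr h1.le)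
      · exact Or.inr (Or.inr (by rw [h1.1]; linarith))
    have hlen : ∀ i j, i ≠ j → B (Pi.single i 1) (Pi.single j 1) = -1 →
        len (Pi.single i 1) = len (Pi.single j 1) := by
      intro i j hij hB1
      rcases hcases hij with h1 | h1 | h1 | h1
      · rw [h1] at hB1; norm_num at hB1
      · exact h1.2
      · rw [h1] at hB1; linarith
      · exact h1.2
    have htypeB : ∀ p q : ι, B (Pi.single p 1) (Pi.single q 1) = -√2 →
        (∀ i, i ≠ p → i ≠ q → B (Pi.single p 1) (Pi.single i 1) = 0) →
        LinearIndepOn ℝ id Λ := by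
      intro p q hB hleaf
      obtain ⟨u, k, hu, hsurj⟩ := h.exists_isTypeBChain hc hB' hB hleaf
      exact h.linearIndepOn_of_typeB hu hsurj hlen hN h0 ha
    by_cases hleaf : ∀ i, i ≠ p → i ≠ q → B (Pi.single p 1) (Pi.single i 1) = 0
    · exact htypeB p q hB hleaf
    by_cases hleaf' : ∀ i, i ≠ q → i ≠ p → B (Pi.single q 1) (Pi.single i 1) = 0
    · exact htypeB q p (by rw [h.symm, hB]) hleaf'
    push Not at hleaf hleaf'
    obtain ⟨r, hrp, hrq, hpr⟩ := hleaf
    obtain ⟨s, hsq, hsp, hqs⟩ := hleaf'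
    exact h.linearIndepOn_of_typeF hc hι hpq hB hrp hrq hsp hsq hpr hqs hN h0 ha
  · refine h.linearIndepOn_of_simplyLaced hc (fun i j hij => ?_) hN h0 ha
    rcases hcases hij with h1 | h1 | h1 | h1
    · exact Or.inl h1
    · exact Or.inr h1
    · exact absurd ⟨i, j, hij, h1⟩ hF
    · exact absurd ⟨i, j, hij, h1⟩ hH

end NormalizedSystem

/-! ### Reduction to connected diagrams -/

/-- Extension by zero of the coordinates indexed by `T`. -/
noncomputable def extendCoords {ι : Type*} (T : Set ι) : (T → ℝ) →ₗ[ℝ] (ι → ℝ) :=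
  Function.ExtendByZero.linearMap ℝ Subtype.val

section extendCoords

variable {ι : Type*} (T : Set ι)

theorem extendCoords_apply (x : T → ℝ) (i : T) : extendCoords T x i = x i :=
  Subtype.val_injective.extend_apply x 0 i

theorem extendCoords_apply_of_notMem (x : T → ℝ) {i : ι} (hi : i ∉ T) : extendCoords T x i = 0 :=
  Function.extend_apply' x (0 : ι → ℝ) i (by rintro ⟨j, rfl⟩; exact hi j.2)

theorem extendCoords_injective : Function.Injective (extendCoords T) := fun x y hxy =>
  funext fun i => by rw [← extendCoords_apply T x i, hxy, extendCoords_apply]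

theorem extendCoords_le_iff {x y : T → ℝ} : extendCoords T x ≤ extendCoords T y ↔ x ≤ y := by
  constructor
  · intro h i
    have := h i
    rwa [extendCoords_apply, extendCoords_apply] at this
  · intro h i
    by_cases hi : i ∈ T
    · have := h ⟨i, hi⟩
      rwa [← extendCoords_apply T x, ← extendCoords_apply T y] at this
    · rw [extendCoords_apply_of_notMem T x hi, extendCoords_apply_of_notMem T y hi]

theorem extendCoords_single [DecidableEq ι] [DecidableEq T] (i : T) :
    extendCoords T (Pi.single i 1) = Pi.single (i : ι) 1 := by
  funext j
  by_cases hj : j ∈ T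
  · obtain ⟨k, rfl⟩ : ∃ k : T, (k : ι) = j := ⟨⟨j, hj⟩, rfl⟩
    rw [extendCoords_apply]
    by_cases hki : k = i
    · subst hki; simp
    · rw [Pi.single_eq_of_ne hki, Pi.single_eq_of_ne fun he => hki (Subtype.ext he)]
  · rw [extendCoords_apply_of_notMem T _ hj, Pi.single_eq_of_ne]
    rintro rfl
    exact hj i.2

theorem mem_range_extendCoords {x : ι → ℝ} (h : ∀ i, i ∉ T → x i = 0) :
    ∃ y, extendCoords T y = x := by
  refine ⟨fun i => x i, funext fun i => ?_⟩
  by_cases hi : i ∈ T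
  · exact extendCoords_apply T _ ⟨i, hi⟩
  · rw [extendCoords_apply_of_notMem T _ hi, h i hi]

end extendCoords

namespace NormalizedSystem

set_option linter.unusedSectionVars false

variable {ι : Type*} [Fintype ι] [DecidableEq ι] {B : LinearMap.BilinForm ℝ (ι → ℝ)}
  {N : Set (ι → ℝ)} {len : (ι → ℝ) → ℝ}

theorem restrict (h : NormalizedSystem B N len) (T : Set ι) [DecidableEq T] :
    NormalizedSystem (B.compl₁₂ (extendCoords T) (extendCoords T)) (extendCoords T ⁻¹' N)
      (len ∘ extendCoords T) where
  symm x y := h.symm _ _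
  pos x hx := h.pos _ fun he => hx (extendCoords_injective T (he.trans (map_zero _).symm))
  finite := h.finite.preimage (extendCoords_injective T).injOn
  norm x hx := h.norm _ hx
  single_mem i := by
    rw [Set.mem_preimage, extendCoords_single]
    exact h.single_mem i
  refl_mem i x hx := by
    rw [Set.mem_preimage, map_sub, map_smul, LinearMap.compl₁₂_apply, extendCoords_single]
    exact h.refl_mem i _ hx
  len_refl i x hx := by
    rw [Function.comp, map_sub, map_smul, LinearMap.compl₁₂_apply, extendCoords_single]
    exact h.len_refl i _ hx
  sign x hx := by
    rw [← extendCoords_le_iff, ← extendCoords_le_iff, map_zero]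
    exact h.sign _ hx

/-- A simple reflection from one block fixes every vector supported on the other, so the property
spreads from the simple roots to all positive roots. -/
theorem support_subset_or (h : NormalizedSystem B N len) {S : Set ι}
    (hS : ∀ i ∈ S, ∀ j ∉ S, B (Pi.single i 1) (Pi.single j 1) = 0) :
    ∀ x ∈ N, 0 ≤ x → (∀ i, i ∉ S → x i = 0) ∨ (∀ i, i ∉ Sᶜ → x i = 0) := by
  refine h.positive_induction _ (fun i => ?_) fun i x _ _ _ hP => ?_
  · by_cases hi : i ∈ S
    · exact Or.inl fun j hj => Pi.single_eq_of_ne (by rintro rfl; exact hj hi) _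
    · exact Or.inr fun j hj => Pi.single_eq_of_ne (by rintro rfl; exact hj hi) _
  · have hzero : (∀ j, x j = 0 ∨ B (Pi.single i 1) (Pi.single j 1) = 0) →
        B x (Pi.single i 1) = 0 := by
      intro hj
      rw [h.symm, bilin_eq_sum]
      refine Finset.sum_eq_zero fun j _ => ?_
      rcases hj j with h1 | h1 <;> simp [h1]
    by_cases hi : i ∈ S
    · refine hP.imp (fun hx j hj => ?_) fun hx => ?_
      · have hji : j ≠ i := fun he => hj (he ▸ hi)
        simp [hx j hj, hji]
      · have h1 := hzero fun j => by
          by_cases hj : j ∈ S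
          · exact Or.inl (hx j fun hj' => hj' hj)
          · exact Or.inr (hS i hi j hj)
        rw [h1, zero_smul, sub_zero]
        exact hx
    · refine hP.imp (fun hx => ?_) fun hx j hj => ?_
      · have h1 := hzero fun j => by
          by_cases hj : j ∈ S
          · exact Or.inr (by rw [h.symm]; exact hS j hj i hi)
          · exact Or.inl (hx j hj)
        rw [h1, zero_smul, sub_zero]
        exact hx
      · have hji : j ≠ i := fun he => hj (he ▸ hi)
        simp [hx j hj, hji]

/-- Length antichains of positive roots are linearly independent. -/
theorem linearIndepOn_of_isLengthAntichain (n : ℕ) : ∀ {ι : Type} [Fintype ι] [DecidableEq ι]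
    {B : LinearMap.BilinForm ℝ (ι → ℝ)} {N : Set (ι → ℝ)} {len : (ι → ℝ) → ℝ},
    Fintype.card ι = n → NormalizedSystem B N len → ∀ {Λ : Set (ι → ℝ)}, Λ ⊆ N →
    (∀ x ∈ Λ, 0 ≤ x) → IsLengthAntichain len Λ → LinearIndepOn ℝ id Λ := by
  classical
  induction n using Nat.strong_induction_on with
  | _ n ih =>
    intro ι _ _ B N len hn h Λ hN h0 ha
    by_cases hc : IsConnectedForm B
    · exact h.linearIndepOn_of_connected hc hN h0 ha
    -- The part of `Λ` supported on a proper subset of the simple roots falls under the induction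
    -- hypothesis.
    have hsub : ∀ T : Set ι, T ≠ Set.univ →
        LinearIndepOn ℝ id (extendCoords T '' (extendCoords T ⁻¹' Λ)) := by
      intro T hT
      obtain ⟨z, hz⟩ := (Set.ne_univ_iff_exists_notMem T).1 hT
      have hcard : Fintype.card T < n := hn ▸ Fintype.card_subtype_lt hz
      have h1 := ih _ hcard rfl (h.restrict T) (Λ := extendCoords T ⁻¹' Λ) (fun x hx => hN hx)
        (fun x hx => by
          rw [← extendCoords_le_iff, map_zero]
          exact h0 _ hx)
        (fun x hx y hy hxy hl hle => ha _ hx _ hy (fun he => hxy (extendCoords_injective T he)) hl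
          ((extendCoords_le_iff T).2 hle))
      refine h1.image ?_
      rw [LinearMap.ker_eq_bot.2 (extendCoords_injective T)]
      exact disjoint_bot_right
    unfold IsConnectedForm at hc
    push Not at hc
    obtain ⟨S, ⟨a, haS⟩, hS, z, hz⟩ := hc
    have hS' : ∀ i ∈ S, ∀ j ∉ S, B (Pi.single i 1) (Pi.single j 1) = 0 := by
      intro i hi j hj
      by_contra hne
      exact hj (hS i hi j hne)
    have hu := LinearIndepOn.id_union (hsub S fun he => hz (he ▸ Set.mem_univ z))
      (hsub Sᶜ fun he => (he ▸ Set.mem_univ a : a ∈ Sᶜ) haS) (by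
        rw [Submodule.disjoint_def]
        intro x hx hx'
        have key : ∀ T : Set ι, x ∈ Submodule.span ℝ (extendCoords T '' (extendCoords T ⁻¹' Λ)) →
            ∀ i, i ∉ T → x i = 0 := by
          intro T hxT i hi
          have : Submodule.span ℝ (extendCoords T '' (extendCoords T ⁻¹' Λ)) ≤
              LinearMap.ker (LinearMap.proj i : (ι → ℝ) →ₗ[ℝ] ℝ) := by
            rw [Submodule.span_le]
            rintro _ ⟨y, -, rfl⟩
            exact extendCoords_apply_of_notMem T y hi
          exact this hxT
        funext i
        by_cases hi : i ∈ S
        · exact key Sᶜ hx' i fun hi' => hi' hi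
        · exact key S hx i hi)
    refine hu.mono fun x hx => ?_
    rcases h.support_subset_or hS' x (hN hx) (h0 x hx) with h1 | h1
    · obtain ⟨y, rfl⟩ := mem_range_extendCoords S h1
      exact Or.inl ⟨y, hx, rfl⟩
    · obtain ⟨y, rfl⟩ := mem_range_extendCoords Sᶜ h1
      exact Or.inr ⟨y, hx, rfl⟩

end NormalizedSystem

/-! ### Normalizing a Euclidean root system -/

section Normalization

variable {V : Type*} [NormedAddCommGroup V] [InnerProductSpace ℝ V]

open Submodule in
theorem reflection_orthogonal_span_singleton (u v : V) :
    (span ℝ {u})ᗮ.reflection v = v - (2 * inner ℝ u v / ‖u‖ ^ 2) • u := by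
  rw [reflection_orthogonal_apply, reflection_singleton_apply]
  simp only [RCLike.ofReal_real_eq_id, id, two_smul, ← add_smul, neg_sub]
  congr 2
  ring

/-- The scaling of a nonzero vector to norm square `2`. -/
noncomputable def rescale (v : V) : V := (√2 / ‖v‖) • v

theorem smul_rescale {v : V} (hv : v ≠ 0) : (‖v‖ / √2) • rescale v = v := by
  have h1 : ‖v‖ ≠ 0 := norm_ne_zero_iff.2 hv
  rw [rescale, smul_smul, div_mul_div_cancel₀ (by positivity), div_self h1, one_smul]

theorem inner_rescale_self {v : V} (hv : v ≠ 0) : inner ℝ (rescale v) (rescale v) = 2 := by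
  have h1 : ‖v‖ ≠ 0 := norm_ne_zero_iff.2 hv
  rw [rescale, real_inner_smul_left, real_inner_smul_right, real_inner_self_eq_norm_sq]
  field_simp
  exact Real.sq_sqrt (by norm_num)

theorem reflection_eq_rescale {u : V} (hu : u ≠ 0) (v : V) :
    (Submodule.span ℝ {u})ᗮ.reflection v = v - inner ℝ v (rescale u) • rescale u := by
  have h1 : ‖u‖ ≠ 0 := norm_ne_zero_iff.2 hu
  rw [reflection_orthogonal_span_singleton, rescale, real_inner_smul_right, smul_smul,
    real_inner_comm]
  congr 2
  field_simp
  rw [Real.sq_sqrt (by norm_num)]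
  ring

namespace IsEuclideanRootSystem

variable {Φ : Set V} {n : ℕ} {α : Fin n → V}

theorem ne_zero (hΦ : IsEuclideanRootSystem Φ) {β : V} (hβ : β ∈ Φ) : β ≠ 0 :=
  fun h => hΦ.zero_notMem (h ▸ hβ)

/-- A ray contains at most one root, so the scale chosen in `originalScale` is unique. -/
theorem eq_of_smul_mem (hΦ : IsEuclideanRootSystem Φ) {a b : ℝ} (ha : 0 < a) (hb : 0 < b) {v : V}
    (hav : a • v ∈ Φ) (hbv : b • v ∈ Φ) : a = b := by
  have hv : v ≠ 0 := by
    rintro rfl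
    exact hΦ.zero_notMem (by simpa using hav)
  have h1 : b • v ∈ Φ ∩ (Submodule.span ℝ {a • v} : Set V) := by
    refine ⟨hbv, Submodule.mem_span_singleton.2 ⟨b / a, ?_⟩⟩
    rw [smul_smul, div_mul_cancel₀ _ ha.ne']
  rw [hΦ.inter_line _ hav] at h1
  rcases h1 with h1 | h1
  · exact (smul_left_injective ℝ hv h1).symm
  · rw [Set.mem_singleton_iff, ← neg_smul] at h1
    have := smul_left_injective ℝ hv h1
    linarith

theorem reflection_mem (hΦ : IsEuclideanRootSystem Φ) {β γ : V} (hβ : β ∈ Φ) (hγ : γ ∈ Φ) :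
    γ - inner ℝ γ (rescale β) • rescale β ∈ Φ := by
  rw [← reflection_eq_rescale (hΦ.ne_zero hβ), ← hΦ.reflection_image β hβ]
  exact ⟨γ, hγ, rfl⟩

end IsEuclideanRootSystem

/-- The linear combination of the normalized vectors `α i` with given coefficients. -/
noncomputable def ofCoords {n : ℕ} (α : Fin n → V) : (Fin n → ℝ) →ₗ[ℝ] V :=
  Fintype.linearCombination ℝ fun i => rescale (α i)

/-- The factor by which the vector with the given coordinates has to be rescaled to be in `Φ`. -/
noncomputable def originalScale (Φ : Set V) {n : ℕ} (α : Fin n → V) (x : Fin n → ℝ) : ℝ :=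
  open Classical in if h : ∃ l : ℝ, 0 < l ∧ l • ofCoords α x ∈ Φ then h.choose else 0

section

variable {Φ : Set V} {n : ℕ} {α : Fin n → V}

theorem ofCoords_single (i : Fin n) : ofCoords α (Pi.single i 1) = rescale (α i) := by
  simp [ofCoords]

theorem originalScale_eq (hΦ : IsEuclideanRootSystem Φ) {l : ℝ} (hl : 0 < l) {x : Fin n → ℝ}
    (hx : l • ofCoords α x ∈ Φ) : originalScale Φ α x = l := by
  have h : ∃ l : ℝ, 0 < l ∧ l • ofCoords α x ∈ Φ := ⟨l, hl, hx⟩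
  rw [originalScale, dif_pos h]
  exact hΦ.eq_of_smul_mem h.choose_spec.1 hl h.choose_spec.2 hx

theorem ofCoords_injective (hΦ : IsEuclideanRootSystem Φ) (hα : IsSimpleSystem Φ α) :
    Function.Injective (ofCoords α) := by
  have h1 : LinearIndependent ℝ fun i => rescale (α i) :=
    hα.linearIndependent.units_smul fun i => Units.mk0 (√2 / ‖α i‖)
      (div_ne_zero (by positivity) (norm_ne_zero_iff.2 (hΦ.ne_zero (hα.mem i))))
  exact linearIndependent_iff_injective_fintypeLinearCombination.1 h1

theorem exists_ofCoords_of_isNonnegComb (hΦ : IsEuclideanRootSystem Φ) (hα : IsSimpleSystem Φ α)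
    {v : V} (hv : IsNonnegComb α v) : ∃ x, 0 ≤ x ∧ ofCoords α x = v := by
  obtain ⟨c, hc, rfl⟩ := hv
  refine ⟨fun i => c i * (‖α i‖ / √2), fun i => mul_nonneg (hc i) (by positivity), ?_⟩
  rw [ofCoords, Fintype.linearCombination_apply]
  exact Finset.sum_congr rfl fun i _ => by rw [mul_smul, smul_rescale (hΦ.ne_zero (hα.mem i))]

theorem isNonnegComb_ofCoords {x : Fin n → ℝ} (hx : 0 ≤ x) : IsNonnegComb α (ofCoords α x) := by
  refine ⟨fun i => x i * (√2 / ‖α i‖), fun i => mul_nonneg (hx i) (by positivity), ?_⟩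
  rw [ofCoords, Fintype.linearCombination_apply]
  exact Finset.sum_congr rfl fun i _ => by rw [mul_smul, rescale]

theorem IsEuclideanRootSystem.normalizedSystem (hΦ : IsEuclideanRootSystem Φ)
    (hα : IsSimpleSystem Φ α) :
    NormalizedSystem ((innerₗ V).compl₁₂ (ofCoords α) (ofCoords α))
      {x | (∃ l : ℝ, 0 < l ∧ l • ofCoords α x ∈ Φ) ∧ inner ℝ (ofCoords α x) (ofCoords α x) = (2 : ℝ)}
      (originalScale Φ α) := by
  have hrefl : ∀ i x (l : ℝ), l • ofCoords α x ∈ Φ →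
      l • ofCoords α (x - inner ℝ (ofCoords α x) (rescale (α i)) • Pi.single i 1) ∈ Φ := by
    intro i x l hx
    have h1 := hΦ.reflection_mem (hα.mem i) hx
    rw [map_sub, map_smul, ofCoords_single]
    convert h1 using 1
    rw [real_inner_smul_left]
    module
  have hsign : ∀ x (l : ℝ), 0 < l → IsNonnegComb α (l • ofCoords α x) → 0 ≤ x := by
    intro x l hl hx
    obtain ⟨y, hy, hyx⟩ := exists_ofCoords_of_isNonnegComb hΦ hα hx
    rw [← map_smul] at hyx
    have h1 := ofCoords_injective hΦ hα hyx
    intro i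
    have h2 := hy i
    rw [h1] at h2
    exact nonneg_of_mul_nonneg_right h2 hl
  constructor
  · intro x y
    exact real_inner_comm _ _
  · intro x hx
    have h1 : ofCoords α x ≠ 0 := fun he =>
      hx (ofCoords_injective hΦ hα (he.trans (map_zero _).symm))
    exact real_inner_self_pos.2 h1
  · refine ((hΦ.finite.image rescale).preimage (ofCoords_injective hΦ hα).injOn).subset ?_
    rintro x ⟨⟨l, hl, hx⟩, h2⟩
    refine ⟨_, hx, ?_⟩
    have h3 : ‖ofCoords α x‖ = √2 := by
      rw [real_inner_self_eq_norm_sq] at h2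
      rw [← h2, Real.sqrt_sq (norm_nonneg _)]
    have h4 : √2 ≠ 0 := by positivity
    rw [rescale, norm_smul, h3, smul_smul, Real.norm_of_nonneg hl.le]
    have : √2 / (l * √2) * l = 1 := by field_simp
    rw [this, one_smul]
  · rintro x ⟨-, hx⟩
    exact hx
  · intro i
    have h0 := hΦ.ne_zero (hα.mem i)
    refine ⟨⟨‖α i‖ / √2, by positivity, ?_⟩, ?_⟩
    · rw [ofCoords_single, smul_rescale h0]
      exact hα.mem i
    · rw [ofCoords_single, inner_rescale_self h0]
  · rintro i x ⟨⟨l, hl, hx⟩, h2⟩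
    have h0 := hΦ.ne_zero (hα.mem i)
    rw [LinearMap.compl₁₂_apply, ofCoords_single, innerₗ_apply_apply]
    refine ⟨⟨l, hl, hrefl i x l hx⟩, ?_⟩
    rw [map_sub, map_smul, ofCoords_single, inner_sub_left, inner_sub_right, inner_sub_right,
      real_inner_smul_left, real_inner_smul_right, real_inner_smul_left, real_inner_smul_right,
      inner_rescale_self h0, h2, real_inner_comm (ofCoords α x) (rescale (α i))]
    ring
  · rintro i x ⟨⟨l, hl, hx⟩, h2⟩
    rw [LinearMap.compl₁₂_apply, ofCoords_single, innerₗ_apply_apply,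
      originalScale_eq hΦ hl hx, originalScale_eq hΦ hl (hrefl i x l hx)]
  · rintro x ⟨⟨l, hl, hx⟩, -⟩
    rcases hα.nonneg_or_nonpos _ hx with h1 | h1
    · exact Or.inl (hsign x l hl h1)
    · refine Or.inr (neg_nonneg.1 (hsign (-x) l hl ?_))
      rwa [map_neg, smul_neg]

theorem IsSimpleSystem.span_eq (hα : IsSimpleSystem Φ α) :
    Submodule.span ℝ Φ = Submodule.span ℝ (Set.range α) := by
  have hcomb : ∀ v, IsNonnegComb α v → v ∈ Submodule.span ℝ (Set.range α) := by
    rintro _ ⟨c, -, rfl⟩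
    exact Submodule.sum_mem _ fun i _ => Submodule.smul_mem _ _ (Submodule.subset_span ⟨i, rfl⟩)
  refine le_antisymm (Submodule.span_le.2 fun β hβ => ?_) (Submodule.span_mono ?_)
  · rcases hα.nonneg_or_nonpos β hβ with h1 | h1
    · exact hcomb _ h1
    · exact neg_mem_iff.1 (hcomb _ h1)
  · rintro _ ⟨i, rfl⟩
    exact hα.mem i

/-- The normalized coordinates of the elements of `Λ` form a length antichain: for equal scales, an
inequality between normalized roots can be multiplied by the common scale and becomes one between
elements of `Λ`. Independence passes back through the injective map `ofCoords` and the nonzero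
scales. -/
theorem linearIndepOn_of_antichain (hΦ : IsEuclideanRootSystem Φ) (hα : IsSimpleSystem Φ α)
    {Λ : Set V} (hΛ : Λ ⊆ positiveRoots Φ α) (hanti : IsAntichain (RootLE α) Λ) :
    LinearIndepOn ℝ id Λ := by
  have hsys := hΦ.normalizedSystem hα
  have hinj := ofCoords_injective hΦ hα
  set N := {x | (∃ l : ℝ, 0 < l ∧ l • ofCoords α x ∈ Φ) ∧
    inner ℝ (ofCoords α x) (ofCoords α x) = (2 : ℝ)}
  set len := originalScale Φ α with hlen
  have hpos : ∀ x ∈ N, 0 < len x := by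
    rintro x ⟨⟨l, hl, hx⟩, -⟩
    rw [hlen, originalScale_eq hΦ hl hx]
    exact hl
  set Λ' : Set (Fin n → ℝ) := {x | x ∈ N ∧ 0 ≤ x ∧ len x • ofCoords α x ∈ Λ} with hΛ'
  have hind : LinearIndepOn ℝ id Λ' := by
    refine NormalizedSystem.linearIndepOn_of_isLengthAntichain n (by simp) hsys (fun x hx => hx.1)
      (fun x hx => hx.2.1) fun x hx y hy hxy hl hle => ?_
    refine hanti hx.2.2 hy.2.2 (fun he => hxy (hinj ?_)) ?_
    · rw [hl] at he
      exact smul_right_injective V (hpos y hy.1).ne' he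
    · rw [RootLE, hl, ← map_smul, ← map_smul, ← map_sub, ← smul_sub]
      exact isNonnegComb_ofCoords (smul_nonneg (hpos y hy.1).le (sub_nonneg.2 hle))
  have h1 : LinearIndependent ℝ fun x : Λ' => ofCoords α x :=
    LinearIndependent.map' hind (ofCoords α) (LinearMap.ker_eq_bot.2 hinj)
  have h2 := (h1.units_smul fun x => Units.mk0 (len x) (hpos x x.2.1).ne').linearIndepOn_id
  refine h2.mono fun β hβ => ?_
  have hβΦ := (hΛ hβ).1
  have hβ0 := hΦ.ne_zero hβΦ
  have hs : 0 < ‖β‖ / √2 := by positivity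
  obtain ⟨y, hy, hyβ⟩ := exists_ofCoords_of_isNonnegComb hΦ hα (hΛ hβ).2
  have hx : ofCoords α ((√2 / ‖β‖) • y) = rescale β := by
    rw [map_smul, hyβ, rescale]
  have hxβ : (‖β‖ / √2) • ofCoords α ((√2 / ‖β‖) • y) = β := by
    rw [hx, smul_rescale hβ0]
  have hl : len ((√2 / ‖β‖) • y) = ‖β‖ / √2 :=
    originalScale_eq hΦ hs (by rw [hxβ]; exact hβΦ)
  refine ⟨⟨(√2 / ‖β‖) • y, ⟨⟨‖β‖ / √2, hs, by rw [hxβ]; exact hβΦ⟩, ?_⟩,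
    smul_nonneg (by positivity) hy, by rw [hl, hxβ]; exact hβ⟩, ?_⟩
  · rw [hx, inner_rescale_self hβ0]
  · change len ((√2 / ‖β‖) • y) • ofCoords α ((√2 / ‖β‖) • y) = β
    rw [hl, hxβ]

end

end Normalization

/-! ### The proposition -/

theorem proposition2p12 {V : Type*} [NormedAddCommGroup V] [InnerProductSpace ℝ V]
    [FiniteDimensional ℝ V] (Φ : Set V) (hΦ : IsEuclideanRootSystem Φ)
    {n : ℕ} (α : Fin n → V) (hα : IsSimpleSystem Φ α)
    (Λ : Set V) (hΛ : Λ ⊆ positiveRoots Φ α) (hanti : IsAntichain (RootLE α) Λ) :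
    LinearIndepOn ℝ id Λ ∧ Λ.encard ≤ n ∧ n = rootSystemRank Φ := by
  have hind := linearIndepOn_of_antichain hΦ hα hΛ hanti
  have hrank : n = rootSystemRank Φ := by
    rw [rootSystemRank, hα.span_eq, finrank_span_eq_card hα.linearIndependent, Fintype.card_fin]
  refine ⟨hind, ?_, hrank⟩
  have hfin : Λ.Finite := hΦ.finite.subset fun β hβ => (hΛ hβ).1
  have := hfin.fintype
  have h1 : Fintype.card Λ = Module.finrank ℝ (Submodule.span ℝ Λ) := by
    have := finrank_span_eq_card hind
    have hr : (Set.range fun x : Λ => id (x : V)) = Λ := Subtype.range_coe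
    rw [← this, hr]
  have h2 : Module.finrank ℝ (Submodule.span ℝ Λ) ≤ n := by
    rw [hrank]
    exact Submodule.finrank_mono (Submodule.span_mono fun β hβ => (hΛ hβ).1)
  rw [← Set.coe_fintypeCard, h1]
  exact_mod_cast h2
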